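/- Let $\Gamma$ be a compact connected metric graph: finitely many vertices $\mathcal V$ and oriented edges $\mathcal E$ (loops and parallel edges allowed), each edge $e$ identified with $[0,\ell_e]$, $\ell_e>0$. Let $B\subset\mathcal V$ be an arbitrary set of vertices of degree two (interior points of edges may be declared vertices of degree two), the edges being oriented so that each $v\in B$ has one ingoing and one outgoing edge. For a function $f$ on $\Gamma$ and $v\in B$ let $f_1(v),f_1'(v)$ be the value and derivative at $v$ along the ingoing edge, and $f_2(v),f_2'(v)$ those along the outgoing edge, derivatives being taken in the direction of the orientation. For $t\in[0,\infty]$ let $H^0(t)=-\frac{d^2}{dx^2}$ in $L^2(\Gamma)=\bigoplus_e L^2([0,\ell_e])$, with domain all $f\in H^2(\Gamma)=\bigoplus_e H^2([0,\ell_e])$ that satisfy the Neumann–Kirchhoff condition at every $v\in\mathcal V\setminus B$ (continuity at $v$, and the derivatives directed from $v$ into the edges sum to zero) and, at every $v\in B$, the $\delta_0$ (that is, $\delta'$) condition $$f_1'(v)=f_2'(v),\qquad f_1(v)-f_2(v)=t\,f_1'(v)\qquad(0\le t<\infty),\qquad\qquad f_1'(v)=f_2'(v)=0\qquad (t=\infty).$$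 For $\lambda\in\mathbb R$, the spectral flow of $(H^0(t))_{t\in[0,\infty]}$ through $\lambda$ is $$\mathrm{Sf}_\lambda^{\delta_0}[0,\infty]=\sum_{l=1}^N\ \sum_{a_l\le\mu<\lambda}\Bigl(\dim\ker\bigl(H^0(t_{l-1})-\mu\bigr)-\dim\ker\bigl(H^0(t_l)-\mu\bigr)\Bigr),$$ where $0=t_0<t_1<\dots<t_N=\infty$ and $a_l<\lambda<b_l$ are such that $a_l,b_l\notin\mathrm{Spec}\,H^0(t)$ for all $t\in[t_{l-1},t_l]$, $1\le l\le N$. Let $\Gamma_{cut}$ be the metric graph obtained from $\Gamma$ by cutting at $B$, i.e. by replacing each $v\in B$ by two vertices of degree one, one for each of the two edge ends at $v$. For a graph with $E$ edges, $V$ vertices and $C$ connected components let $\beta=E-V+C$ be its first Betti number. Then there is $\epsilon_0>0$ such that for all $0<\epsilon<\epsilon_0$ the spectral flow through $\epsilon$ is well defined (such partitions and intervals exist, and the sum does not depend on their choice) and $$\mathrm{Sf}_\epsilon^{\delta_0}[0,\infty]=\beta_\Gamma-\beta_{\Gamma_{cut}}.$$ -/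

import Mathlib

noncomputable section

open MeasureTheory Set
open scoped ENNReal

/-! ### Unbounded operators: resolvent set, spectrum, spectral flow -/

section Operators

variable {F : Type*} [NormedAddCommGroup F] [NormedSpace ℂ F]

/-- The spectrum of an unbounded operator `A`: the complement of the set of all `z` for which
`A - z : Dom A → F` has an everywhere defined bounded two-sided inverse `R`. -/
def unboundedSpectrum (A : F →ₗ.[ℂ] F) : Set ℂ :=
  {z | ¬ ∃ R : F →L[ℂ] F,
    (∀ g : F, ∃ h : R g ∈ A.domain, A ⟨R g, h⟩ - z • R g = g) ∧
    (∀ f : A.domain, R (A f - z • (f : F)) = f)}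

/-- `dim ker (A - z)`. -/
def dimKer (A : F →ₗ.[ℂ] F) (z : ℂ) : ℕ :=
  Module.finrank ℂ (LinearMap.ker (A.toFun - z • A.domain.subtype))

/-- A partition `a = t₀ < t₁ < ⋯ < t_N = b` together with windows `[lo l, hi l]` around `lam`
whose endpoints avoid the spectra of `H t` for all `t` in the `l`-th piece. -/
structure FlowPartition (H : EReal → F →ₗ.[ℂ] F) (a b : EReal) (lam : ℝ) where
  N : ℕ
  t : Fin (N + 1) → EReal
  strictMono : StrictMono t
  first : t 0 = a
  last : t (Fin.last N) = b
  lo : Fin N → ℝ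
  hi : Fin N → ℝ
  lo_lt : ∀ l, lo l < lam
  lt_hi : ∀ l, lam < hi l
  lo_notMem : ∀ l, ∀ s ∈ Icc (t l.castSucc) (t l.succ), ((lo l : ℝ) : ℂ) ∉ unboundedSpectrum (H s)
  hi_notMem : ∀ l, ∀ s ∈ Icc (t l.castSucc) (t l.succ), ((hi l : ℝ) : ℂ) ∉ unboundedSpectrum (H s)

/-- `∑_l ∑_{lo l ≤ μ < lam} (dim ker (H t_{l-1} - μ) - dim ker (H t_l - μ))`. -/
def FlowPartition.flow {H : EReal → F →ₗ.[ℂ] F} {a b : EReal} {lam : ℝ}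
    (P : FlowPartition H a b lam) : ℤ :=
  ∑ l : Fin P.N, ∑ᶠ μ ∈ Ico (P.lo l) lam,
    ((dimKer (H (P.t l.castSucc)) ((μ : ℝ) : ℂ) : ℤ) - (dimKer (H (P.t l.succ)) ((μ : ℝ) : ℂ) : ℤ))

/-- The spectral flow of `H` through `lam` along `[a, b]` is well defined (a partition as above
exists and the sum does not depend on it) and equals `n`. -/
def HasSpectralFlow (H : EReal → F →ₗ.[ℂ] F) (a b : EReal) (lam : ℝ) (n : ℤ) : Prop :=
  Nonempty (FlowPartition H a b lam) ∧ ∀ P : FlowPartition H a b lam, P.flow = n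

end Operators

/-! ### Metric graphs -/

/-- A metric graph with vertex set `V` and oriented edges `E`; loops and parallel edges are
allowed. The edge `e` is identified with `[0, len e]`, running from `src e` to `tgt e`. -/
structure MetricGraph (V E : Type*) where
  src : E → V
  tgt : E → V
  len : E → ℝ
  len_pos : ∀ e, 0 < len e

namespace MetricGraph

variable {V E : Type*} (G : MetricGraph V E)

/-- The number of edge ends at `v`; a loop counts twice. -/
def degree (v : V) : ℕ :=
  Nat.card {e // G.src e = v} + Nat.card {e // G.tgt e = v}

/-- The set of connected components: vertices modulo the equivalence relation generated by
the edges. -/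
def Components : Type _ :=
  Quot fun v w : V => ∃ e, G.src e = v ∧ G.tgt e = w

/-- `G` is non-empty and has only one connected component. -/
def Connected : Prop :=
  Nonempty V ∧ ∀ v w : V, Relation.EqvGen (fun v w : V => ∃ e, G.src e = v ∧ G.tgt e = w) v w

/-- The first Betti number `|E| - |V| + (number of connected components)`. -/
def betti : ℤ :=
  (Nat.card E : ℤ) - (Nat.card V : ℤ) + (Nat.card G.Components : ℤ)

/-- The graph cut at a set `B` of vertices of degree two: every `v ∈ B` is replaced by the two
vertices `inl v`, which keeps the edge leaving `v`, and `inr v`, which keeps the edge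
entering `v`. -/
def cut (B : Set V) : MetricGraph (V ⊕ B) E where
  src e := Sum.inl (G.src e)
  tgt e := open Classical in
    if h : G.tgt e ∈ B then Sum.inr ⟨G.tgt e, h⟩ else Sum.inl (G.tgt e)
  len := G.len
  len_pos := G.len_pos

/-- The Hilbert space `L²(Γ) = ⨁ₑ L²([0, len e])`. -/
abbrev L2 [Fintype E] : Type _ :=
  PiLp 2 fun e : E => Lp ℂ 2 ((volume : Measure ℝ).restrict (Icc 0 (G.len e)))

end MetricGraph

/-- `f ∈ H²([0, ℓ])` with second derivative `w ∈ L²([0, ℓ])`; `u` is the `C¹` representative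
of `f` and `u'` its derivative, an absolutely continuous function with density `w`. -/
structure IsH2Rep (ℓ : ℝ) (f w : Lp ℂ 2 ((volume : Measure ℝ).restrict (Icc 0 ℓ)))
    (u u' : ℝ → ℂ) : Prop where
  ae_eq : f =ᵐ[(volume : Measure ℝ).restrict (Icc 0 ℓ)] u
  deriv : ∀ x ∈ Icc 0 ℓ, HasDerivWithinAt u (u' x) (Icc 0 ℓ) x
  deriv' : ∀ x ∈ Icc 0 ℓ, u' x = u' 0 + ∫ y in (0 : ℝ)..x, w y

theorem IsH2Rep.zero (ℓ : ℝ) : IsH2Rep ℓ 0 0 0 0 where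
  ae_eq := Lp.coeFn_zero ..
  deriv x _ := hasDerivWithinAt_const x (Icc 0 ℓ) (0 : ℂ)
  deriv' x hx := by
    have h : (((0 : Lp ℂ 2 ((volume : Measure ℝ).restrict (Icc 0 ℓ))) : ℝ → ℂ))
        =ᵐ[(volume : Measure ℝ).restrict (uIoc 0 x)] 0 := by
      rw [uIoc_of_le hx.1]
      exact ae_restrict_of_ae_restrict_of_subset
        (Ioc_subset_Icc_self.trans (Icc_subset_Icc_right hx.2)) (Lp.coeFn_zero ℂ 2 _)
    rw [intervalIntegral.integral_congr_ae_restrict h]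
    simp

theorem IsH2Rep.intervalIntegrable {ℓ x : ℝ} (hx : x ∈ Icc 0 ℓ)
    (w : Lp ℂ 2 ((volume : Measure ℝ).restrict (Icc 0 ℓ))) :
    IntervalIntegrable w volume 0 x := by
  rw [intervalIntegrable_iff, uIoc_of_le hx.1]
  have h : IntegrableOn w (Icc 0 ℓ) volume := (Lp.memLp w).integrable (by norm_num)
  exact h.mono_set fun y hy => ⟨hy.1.le, hy.2.trans hx.2⟩

theorem IsH2Rep.add {ℓ : ℝ} {f w g z : Lp ℂ 2 ((volume : Measure ℝ).restrict (Icc 0 ℓ))}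
    {u u' v v' : ℝ → ℂ} (h : IsH2Rep ℓ f w u u') (k : IsH2Rep ℓ g z v v') :
    IsH2Rep ℓ (f + g) (w + z) (u + v) (u' + v') where
  ae_eq := (Lp.coeFn_add f g).trans (h.ae_eq.add k.ae_eq)
  deriv x hx := (h.deriv x hx).add (k.deriv x hx)
  deriv' x hx := by
    have e : ((w + z : Lp ℂ 2 ((volume : Measure ℝ).restrict (Icc 0 ℓ))) : ℝ → ℂ)
        =ᵐ[(volume : Measure ℝ).restrict (uIoc 0 x)] fun y => w y + z y := by
      rw [uIoc_of_le hx.1]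
      exact ae_restrict_of_ae_restrict_of_subset
        (Ioc_subset_Icc_self.trans (Icc_subset_Icc_right hx.2)) (Lp.coeFn_add w z)
    rw [intervalIntegral.integral_congr_ae_restrict e, intervalIntegral.integral_add
      (IsH2Rep.intervalIntegrable hx w) (IsH2Rep.intervalIntegrable hx z)]
    simp only [Pi.add_apply, h.deriv' x hx, k.deriv' x hx]
    ring

theorem IsH2Rep.smul {ℓ : ℝ} {f w : Lp ℂ 2 ((volume : Measure ℝ).restrict (Icc 0 ℓ))}
    {u u' : ℝ → ℂ} (c : ℂ) (h : IsH2Rep ℓ f w u u') :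
    IsH2Rep ℓ (c • f) (c • w) (c • u) (c • u') where
  ae_eq := (Lp.coeFn_smul c f).trans (h.ae_eq.const_smul c)
  deriv x hx := (h.deriv x hx).const_smul c
  deriv' x hx := by
    have e : ((c • w : Lp ℂ 2 ((volume : Measure ℝ).restrict (Icc 0 ℓ))) : ℝ → ℂ)
        =ᵐ[(volume : Measure ℝ).restrict (uIoc 0 x)] fun y => c • w y := by
      rw [uIoc_of_le hx.1]
      exact ae_restrict_of_ae_restrict_of_subset
        (Ioc_subset_Icc_self.trans (Icc_subset_Icc_right hx.2)) (Lp.coeFn_smul c w)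
    rw [intervalIntegral.integral_congr_ae_restrict e, intervalIntegral.integral_smul]
    simp only [Pi.smul_apply, h.deriv' x hx, smul_add]

theorem IsH2Rep.eq_zero {ℓ : ℝ} (hℓ : 0 < ℓ)
    {f w : Lp ℂ 2 ((volume : Measure ℝ).restrict (Icc 0 ℓ))}
    {u u' : ℝ → ℂ} (h : IsH2Rep ℓ f w u u') (hf : f = 0) : w = 0 := by
  have hu : EqOn u 0 (Icc 0 ℓ) := by
    have h1 : u =ᵐ[(volume : Measure ℝ).restrict (Icc 0 ℓ)] 0 := by
      subst hf
      exact h.ae_eq.symm.trans (Lp.coeFn_zero ..)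
    refine Measure.eqOn_Icc_of_ae_eq volume hℓ.ne h1
      (fun x hx => (h.deriv x hx).continuousWithinAt) continuousOn_const
  have hu' : EqOn u' 0 (Icc 0 ℓ) := fun x hx => by
    have h1 : HasDerivWithinAt (fun _ : ℝ => (0 : ℂ)) (u' x) (Icc 0 ℓ) x :=
      (h.deriv x hx).congr (fun y hy => (hu hy).symm) (hu hx).symm
    exact (uniqueDiffOn_Icc hℓ x hx).eq_deriv _ h1 (hasDerivWithinAt_const ..)
  have hae : ∀ᵐ x ∂(volume : Measure ℝ), x ∈ Icc 0 ℓ → w x = 0 := by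
    have hi : IntervalIntegrable w volume 0 ℓ :=
      IsH2Rep.intervalIntegrable (right_mem_Icc.2 hℓ.le) w
    have h0 : (0 : ℝ) ∈ uIcc 0 ℓ := left_mem_uIcc
    filter_upwards [hi.ae_hasDerivAt_integral, Measure.ae_ne volume 0, Measure.ae_ne volume ℓ]
      with x hx hx0 hxl hxm
    have hd := hx (by rwa [uIcc_of_le hℓ.le]) 0 h0
    have hz : (fun z => ∫ y in (0 : ℝ)..z, w y) =ᶠ[nhds x] fun _ => 0 := by
      filter_upwards [Icc_mem_nhds (lt_of_le_of_ne hxm.1 (Ne.symm hx0))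
        (lt_of_le_of_ne hxm.2 hxl)] with z hz
      have := h.deriv' z hz
      rw [hu' hz, hu' (left_mem_Icc.2 hℓ.le)] at this
      simpa using this.symm
    exact (hd.congr_of_eventuallyEq hz.symm).unique (hasDerivAt_const x (0 : ℂ))
  rw [Lp.eq_zero_iff_ae_eq_zero]
  exact (ae_restrict_iff' measurableSet_Icc).2 hae

/-- The rotated trace `γ = cos α · f - sin α · f'`. -/
def robinTrace (α : ℝ) (f f' : ℂ) : ℂ := (Real.cos α : ℂ) * f - (Real.sin α : ℂ) * f'

/-- The dual rotated trace `γ⋆ = sin α · f + cos α · f'`. -/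
def robinTraceStar (α : ℝ) (f f' : ℂ) : ℂ := (Real.sin α : ℂ) * f + (Real.cos α : ℂ) * f'

/-- The `δ_s` vertex condition, `s = cot α`, with parameter `t`, for the one-sided values
`f₁, f₂` and derivatives `f₁', f₂'` along the orientation; at `t = ±∞` it decouples. -/
def DeltaCond (α : ℝ) (t : EReal) (f₁ f₁' f₂ f₂' : ℂ) : Prop :=
  ((t = ⊤ ∨ t = ⊥) → robinTrace α f₁ f₁' = 0 ∧ robinTrace α f₂ f₂' = 0) ∧
  (∀ r : ℝ, t = (r : EReal) → robinTrace α f₁ f₁' = robinTrace α f₂ f₂' ∧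
    robinTraceStar α f₂ f₂' - robinTraceStar α f₁ f₁' = (r : ℂ) * robinTrace α f₁ f₁')

namespace MetricGraph

variable {V E : Type*} (G : MetricGraph V E) [Fintype E]

open Classical in
/-- The Neumann–Kirchhoff condition at `v`: continuity, and the sum of the derivatives directed
from `v` into the edges vanishes. -/
def KirchhoffAt (v : V) (u u' : E → ℝ → ℂ) : Prop :=
  (∃ c : ℂ, (∀ e, G.src e = v → u e 0 = c) ∧ (∀ e, G.tgt e = v → u e (G.len e) = c)) ∧
  (∑ e with G.src e = v, u' e 0) - (∑ e with G.tgt e = v, u' e (G.len e)) = 0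

/-- The `δ_s` condition at a vertex `v` of degree two, with entering edge `e₁` and leaving
edge `e₂`. -/
def DeltaAt (α : ℝ) (t : EReal) (v : V) (u u' : E → ℝ → ℂ) : Prop :=
  ∀ e₁ e₂, G.tgt e₁ = v → G.src e₂ = v →
    DeltaCond α t (u e₁ (G.len e₁)) (u' e₁ (G.len e₁)) (u e₂ 0) (u' e₂ 0)

/-- The graph of `-d²/dx²` with domain the functions of `H²(Γ)` that satisfy the `δ_s` condition
(`s = cot α`) with parameter `t` at `B` and the Neumann–Kirchhoff condition elsewhere. -/
def deltaGraph (α : ℝ) (B : Set V) (t : EReal) : Submodule ℂ (G.L2 × G.L2) where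
  carrier := {p | ∃ u u' : E → ℝ → ℂ, (∀ e, IsH2Rep (G.len e) (p.1 e) (-(p.2 e)) (u e) (u' e)) ∧
    (∀ v ∈ B, G.DeltaAt α t v u u') ∧ (∀ v ∉ B, G.KirchhoffAt v u u')}
  zero_mem' := by
    refine ⟨0, 0, fun e => by simpa using IsH2Rep.zero (G.len e), fun v _ e₁ e₂ _ _ => ?_,
      fun v _ => ⟨⟨0, by simp, by simp⟩, by simp⟩⟩
    simp [DeltaCond, robinTrace, robinTraceStar]
  add_mem' := by
    rintro p q ⟨u, u', h, hB, hK⟩ ⟨w, w', k, kB, kK⟩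
    refine ⟨u + w, u' + w', fun e => ?_, fun v hv e₁ e₂ h₁ h₂ => ?_, fun v hv => ?_⟩
    · have := (h e).add (k e)
      rw [← neg_add] at this
      exact this
    · have a := hB v hv e₁ e₂ h₁ h₂
      have b := kB v hv e₁ e₂ h₁ h₂
      simp only [DeltaCond, robinTrace, robinTraceStar, Pi.add_apply] at a b ⊢
      refine ⟨fun ht => ⟨?_, ?_⟩, fun r hr => ⟨?_, ?_⟩⟩
      · linear_combination (a.1 ht).1 + (b.1 ht).1
      · linear_combination (a.1 ht).2 + (b.1 ht).2
      · linear_combination (a.2 r hr).1 + (b.2 r hr).1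
      · linear_combination (a.2 r hr).2 + (b.2 r hr).2
    · obtain ⟨⟨c, hc, hc'⟩, hs⟩ := hK v hv
      obtain ⟨⟨d, hd, hd'⟩, ks⟩ := kK v hv
      refine ⟨⟨c + d, fun e he => ?_, fun e he => ?_⟩, ?_⟩
      · simp [hc e he, hd e he]
      · simp [hc' e he, hd' e he]
      · simp only [Pi.add_apply, Finset.sum_add_distrib]
        linear_combination hs + ks
  smul_mem' := by
    rintro c p ⟨u, u', h, hB, hK⟩
    refine ⟨c • u, c • u', fun e => ?_, fun v hv e₁ e₂ h₁ h₂ => ?_, fun v hv => ?_⟩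
    · have := (h e).smul c
      rw [smul_neg] at this
      exact this
    · have a := hB v hv e₁ e₂ h₁ h₂
      simp only [DeltaCond, robinTrace, robinTraceStar, Pi.smul_apply, smul_eq_mul] at a ⊢
      refine ⟨fun ht => ⟨?_, ?_⟩, fun r hr => ⟨?_, ?_⟩⟩
      · linear_combination c * (a.1 ht).1
      · linear_combination c * (a.1 ht).2
      · linear_combination c * (a.2 r hr).1
      · linear_combination c * (a.2 r hr).2
    · obtain ⟨⟨d, hd, hd'⟩, hs⟩ := hK v hv
      refine ⟨⟨c * d, fun e he => ?_, fun e he => ?_⟩, ?_⟩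
      · simp [hd e he]
      · simp [hd' e he]
      · simp only [Pi.smul_apply, smul_eq_mul, ← Finset.mul_sum]
        linear_combination c * hs

/-- `deltaGraph` is the graph of a function, so that `deltaOp` below is the intended operator. -/
theorem deltaGraph_snd_eq_zero (α : ℝ) (B : Set V) (t : EReal) (p : G.L2 × G.L2)
    (hp : p ∈ G.deltaGraph α B t) (h0 : p.1 = 0) : p.2 = 0 := by
  obtain ⟨u, u', h, -, -⟩ := hp
  ext1 e
  have := (h e).eq_zero (G.len_pos e) (by simp [h0])
  simpa using this

/-- The operator `H^s(t)` of the `δ_s` family placed at `B`, with `s = cot α`. -/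
def deltaOp (α : ℝ) (B : Set V) (t : EReal) : G.L2 →ₗ.[ℂ] G.L2 :=
  (G.deltaGraph α B t).toLinearPMap

theorem deltaOp_graph (α : ℝ) (B : Set V) (t : EReal) :
    (G.deltaOp α B t).graph = G.deltaGraph α B t :=
  Submodule.toLinearPMap_graph_eq _ (G.deltaGraph_snd_eq_zero α B t)

end MetricGraph

end

noncomputable section

open MeasureTheory Set
open scoped ENNReal

/-! ### Negative index of Hermitian maps -/

section Index

open Module Filter Topology

variable {n : Type*} [Fintype n]

/-! The spectral flow is computed from a finite-dimensional Hermitian family. Fix `b > 0` so small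
that `√b * len e < π / 2` on every edge. For `μ ≤ b` a solution of `-u'' = μ u` is then determined
on each edge by its end values, and the vertex conditions become a linear equation for the vertex
values. For `0 < t ≤ ∞` the `δ'` condition says that both derivatives equal `t⁻¹ (f₁ - f₂)`, so the
multiplicity of `μ` is the dimension of the kernel of `Λ_cut(μ) - t⁻¹ JᵀJ`, where `Λ_cut` is the
Dirichlet-to-Neumann map of the cut graph and `J` the jump across `B` (`map_harmonicExtension`,
`mem_deltaGraph_of_pos`). At `t = 0` it is the dimension of the kernel of `Λ_Γ(μ)`
(`mem_deltaGraph_zero`).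

The forms of these maps strictly decrease in `μ` (`quadForm_dtn_strictAnti`). Hence their negative
index jumps at each eigenvalue exactly by its multiplicity, and the eigenvalues in `[a, ε)` are
counted by the increase of the index from `a` to `ε` (`finsum_finrank_ker`). At a level that stays
regular along a piece of the parameter interval the index is constant (`levelIndex_eq`). The
contributions of the lower ends of the windows therefore cancel, and the flow telescopes to the
index at `t = 0` minus the index at `t = ∞`, both at level `ε` (`IsAdmissible.flow_eq`).

The end `t = 0` is singular: `t⁻¹` tends to infinity and one eigenvalue for each point of `B`
descends to `-∞`. For strong coupling the index is that of `Λ_Γ(ε)` plus `|B|`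
(`eventually_cutMap`), which is why `levelIndex` adds `|B|` at `t = 0`. At `t = ∞` the coupling
vanishes and `Λ_cut(ε)` remains.

Finally, a Dirichlet-to-Neumann map is nonnegative at `μ = 0` with kernel the functions constant on
components, so just above zero its index is the number of components (`eventually_negIndex_dtn`).
The flow is thus the number of components of `Γ`, plus `|B|`, minus that of the cut graph; this is
the difference of Betti numbers, since cutting keeps the edges and adds `|B|` vertices. -/

/-- `⟨x, T y⟩ = ⟨T x, y⟩` for the standard Hermitian form on `ℂⁿ`. -/
def IsHermitianMap (T : (n → ℂ) →ₗ[ℂ] (n → ℂ)) : Prop :=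
  ∀ x y, star x ⬝ᵥ T y = star (T x) ⬝ᵥ y

/-- The quadratic form `⟨x, T x⟩`. -/
def quadForm (T : (n → ℂ) →ₗ[ℂ] (n → ℂ)) (x : n → ℂ) : ℝ := (star x ⬝ᵥ T x).re

/-- The maximal dimension of a subspace on which `q` is negative definite. -/
def negIndex (q : (n → ℂ) → ℝ) : ℕ :=
  sSup {k | ∃ S : Submodule ℂ (n → ℂ), finrank ℂ S = k ∧ ∀ x ∈ S, x ≠ 0 → q x < 0}

theorem quadForm_smul (T : (n → ℂ) →ₗ[ℂ] (n → ℂ)) (c : ℂ) (x : n → ℂ) :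
    quadForm T (c • x) = ‖c‖ ^ 2 * quadForm T x := by
  have : star (c • x) ⬝ᵥ T (c • x) = ((‖c‖ ^ 2 : ℝ) : ℂ) * (star x ⬝ᵥ T x) := by
    rw [map_smul, star_smul, smul_dotProduct, dotProduct_smul, smul_smul, smul_eq_mul]
    congr 1
    simp [Complex.conj_mul']
  rw [quadForm, this, Complex.re_ofReal_mul, quadForm]

theorem negIndex_bddAbove (q : (n → ℂ) → ℝ) : BddAbove
    {k | ∃ S : Submodule ℂ (n → ℂ), finrank ℂ S = k ∧ ∀ x ∈ S, x ≠ 0 → q x < 0} := by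
  refine ⟨Fintype.card n, ?_⟩
  rintro k ⟨S, rfl, -⟩
  simpa using S.finrank_le

theorem finrank_le_negIndex {q : (n → ℂ) → ℝ} {S : Submodule ℂ (n → ℂ)}
    (h : ∀ x ∈ S, x ≠ 0 → q x < 0) : finrank ℂ S ≤ negIndex q :=
  le_csSup (negIndex_bddAbove q) ⟨S, rfl, h⟩

theorem exists_finrank_eq_negIndex (q : (n → ℂ) → ℝ) :
    ∃ S : Submodule ℂ (n → ℂ), finrank ℂ S = negIndex q ∧ ∀ x ∈ S, x ≠ 0 → q x < 0 :=
  Nat.sSup_mem (s := {k | ∃ S : Submodule ℂ (n → ℂ), finrank ℂ S = k ∧ ∀ x ∈ S, x ≠ 0 → q x < 0})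
    ⟨0, ⊥, by simp, by simp⟩ (negIndex_bddAbove q)

theorem finrank_add_finrank_le {S S' : Submodule ℂ (n → ℂ)} (h : ∀ x ∈ S, x ∈ S' → x = 0) :
    finrank ℂ S + finrank ℂ S' ≤ Fintype.card n := by
  have := Submodule.finrank_add_finrank_le_of_disjoint (Submodule.disjoint_def.2 h)
  simpa using this

/-- `EuclideanSpace` enters only to invoke the spectral theorem. The eigenbasis is exported as a
linear equivalence because later only coordinates and dimensions matter. -/
theorem exists_diagonalization {T : (n → ℂ) →ₗ[ℂ] (n → ℂ)} (hT : IsHermitianMap T) :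
    ∃ (Φ : (n → ℂ) ≃ₗ[ℂ] (Fin (Fintype.card n) → ℂ)) (l : Fin (Fintype.card n) → ℝ),
      (∀ x i, Φ (T x) i = l i * Φ x i) ∧ ∀ x, quadForm T x = ∑ i, l i * ‖Φ x i‖ ^ 2 := by
  let e := WithLp.linearEquiv 2 ℂ (n → ℂ)
  let T' : EuclideanSpace ℂ n →ₗ[ℂ] EuclideanSpace ℂ n := e.symm.toLinearMap ∘ₗ T ∘ₗ e.toLinearMap
  have hin : ∀ x y : EuclideanSpace ℂ n, inner ℂ x y = star (e x) ⬝ᵥ e y := fun x y => by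
    rw [EuclideanSpace.inner_eq_star_dotProduct, dotProduct_comm]; rfl
  have hT' : T'.IsSymmetric := fun x y => by
    rw [hin, hin]
    simpa [T'] using (hT (e x) (e y)).symm
  have hn : finrank ℂ (EuclideanSpace ℂ n) = Fintype.card n := by simp
  let b := hT'.eigenvectorBasis hn
  have hb : ∀ (x : n → ℂ) i, b.repr (e.symm (T x)) i = hT'.eigenvalues hn i * b.repr (e.symm x) i :=
    fun x i => by
      have := hT'.eigenvectorBasis_apply_self_apply hn (e.symm x) i
      simpa [T'] using this
  refine ⟨e.symm ≪≫ₗ b.repr.toLinearEquiv ≪≫ₗ WithLp.linearEquiv 2 ℂ _,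
    hT'.eigenvalues hn, hb, fun x => ?_⟩
  have h1 : quadForm T x = (inner ℂ (e.symm x) (e.symm (T x))).re := by
    rw [hin]; simp [quadForm]
  have h2 : (inner ℂ (b.repr (e.symm x)) (b.repr (e.symm (T x)))) =
      ∑ i, ((hT'.eigenvalues hn i * ‖b.repr (e.symm x) i‖ ^ 2 : ℝ) : ℂ) := by
    rw [PiLp.inner_apply]
    refine Finset.sum_congr rfl fun i _ => ?_
    rw [hb, RCLike.inner_apply, mul_assoc, Complex.mul_conj']
    push_cast
    rfl
  rw [h1, ← b.repr.inner_map_map, h2, ← Complex.ofReal_sum, Complex.ofReal_re]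
  rfl

theorem finrank_coordinate_subspace {n : Type*} {d : ℕ} (Φ : (n → ℂ) ≃ₗ[ℂ] (Fin d → ℂ))
    (p : Fin d → Prop) [DecidablePred p] :
    ∃ S : Submodule ℂ (n → ℂ), finrank ℂ S = (Finset.univ.filter p).card ∧
      ∀ x, x ∈ S ↔ ∀ i, ¬ p i → Φ x i = 0 := by
  let ψ : ({i // p i} → ℂ) →ₗ[ℂ] (Fin d → ℂ) :=
    { toFun := fun y i => if h : p i then y ⟨i, h⟩ else 0
      map_add' := fun x y => by ext i; by_cases h : p i <;> simp [h]
      map_smul' := fun c x => by ext i; by_cases h : p i <;> simp [h] }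
  have hψ : Function.Injective ψ := fun x y h => by
    ext ⟨i, hi⟩
    simpa [ψ, hi] using congrFun h i
  refine ⟨(LinearMap.range ψ).map Φ.symm.toLinearMap, ?_, fun x => ?_⟩
  · rw [LinearEquiv.finrank_map_eq, LinearMap.finrank_range_of_inj hψ]
    simp [Fintype.card_subtype]
  · constructor
    · rintro ⟨_, ⟨y, rfl⟩, rfl⟩ i hi
      simp [ψ, hi]
    · intro h
      refine ⟨Φ x, ⟨fun i => Φ x i, ?_⟩, by simp⟩
      ext i
      by_cases hi : p i
      · simp [ψ, hi]
      · simp [ψ, hi, h i hi]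

/-- The inertia of a Hermitian map. -/
theorem IsHermitianMap.exists_inertia {T : (n → ℂ) →ₗ[ℂ] (n → ℂ)} (hT : IsHermitianMap T) :
    ∃ Z P : Submodule ℂ (n → ℂ),
      finrank ℂ Z = negIndex (quadForm T) + finrank ℂ (LinearMap.ker T) ∧
      finrank ℂ P + finrank ℂ Z = Fintype.card n ∧
      (∀ x ∈ Z, quadForm T x ≤ 0) ∧ ∀ x ∈ P, x ≠ 0 → 0 < quadForm T x := by
  obtain ⟨Φ, l, hl, hq⟩ := exists_diagonalization hT
  -- The five subspaces are spanned by the eigenvectors with eigenvalue `< 0`, `≥ 0`, `= 0`, `≤ 0`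
  -- and `> 0`.
  obtain ⟨N, hN, hNm⟩ := finrank_coordinate_subspace Φ (fun i => l i < 0)
  obtain ⟨A, hA, hAm⟩ := finrank_coordinate_subspace Φ (fun i => ¬ l i < 0)
  obtain ⟨K, hK, hKm⟩ := finrank_coordinate_subspace Φ (fun i => l i = 0)
  obtain ⟨Z, hZ, hZm⟩ := finrank_coordinate_subspace Φ (fun i => l i ≤ 0)
  obtain ⟨P, hP, hPm⟩ := finrank_coordinate_subspace Φ (fun i => ¬ l i ≤ 0)
  have hker : LinearMap.ker T = K := by
    ext x
    rw [LinearMap.mem_ker, hKm, ← Φ.map_eq_zero_iff, funext_iff]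
    refine forall_congr' fun i => ?_
    rw [hl]
    simp [imp_iff_not_or]
  have hNA : finrank ℂ N + finrank ℂ A = Fintype.card n := by
    rw [hN, hA, Finset.card_filter_add_card_filter_not]; simp
  have hPZ : finrank ℂ P + finrank ℂ Z = Fintype.card n := by
    rw [hP, hZ, add_comm, Finset.card_filter_add_card_filter_not]; simp
  have hpos : ∀ x, x ≠ 0 → ∃ i, Φ x i ≠ 0 := fun x hx => by
    by_contra! h
    exact hx (Φ.map_eq_zero_iff.1 (funext h))
  have hneg : finrank ℂ N = negIndex (quadForm T) := by
    apply le_antisymm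
    · refine finrank_le_negIndex fun x hx h0 => ?_
      rw [hNm] at hx
      rw [hq]
      obtain ⟨i, hi⟩ := hpos x h0
      refine Finset.sum_neg' (fun j _ => ?_) ⟨i, Finset.mem_univ _, ?_⟩
      · by_cases hj : l j < 0
        · exact mul_nonpos_of_nonpos_of_nonneg hj.le (by positivity)
        · simp [hx j hj]
      · have : l i < 0 := by by_contra h; exact hi (hx i h)
        exact mul_neg_of_neg_of_pos this (by positivity)
    -- The law of inertia: a negative definite subspace meets `A`, where the form is nonnegative,
    -- only in zero, so its dimension is at most the codimension of `A`.
    · obtain ⟨S, hS, hSq⟩ := exists_finrank_eq_negIndex (quadForm T)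
      have : finrank ℂ S + finrank ℂ A ≤ Fintype.card n := by
        refine finrank_add_finrank_le fun x hx hx' => ?_
        by_contra h0
        have h1 := hSq x hx h0
        rw [hAm] at hx'
        rw [hq] at h1
        refine absurd h1 (not_lt.2 (Finset.sum_nonneg fun j _ => ?_))
        by_cases hj : l j < 0
        · simp [hx' j (not_not.2 hj)]
        · exact mul_nonneg (not_lt.1 hj) (by positivity)
      omega
  refine ⟨Z, P, ?_, hPZ, fun x hx => ?_, fun x hx h0 => ?_⟩
  · rw [← hneg, hker, hN, hK, hZ, ← Finset.card_union_of_disjoint]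
    · congr 1
      ext i
      simp [le_iff_lt_or_eq]
    · rw [Finset.disjoint_filter]
      intro i _ h
      exact h.ne
  · rw [hZm] at hx
    rw [hq]
    refine Finset.sum_nonpos fun j _ => ?_
    by_cases hj : l j ≤ 0
    · exact mul_nonpos_of_nonpos_of_nonneg hj (by positivity)
    · simp [hx j hj]
  · rw [hPm] at hx
    rw [hq]
    obtain ⟨i, hi⟩ := hpos x h0
    refine Finset.sum_pos' (fun j _ => ?_) ⟨i, Finset.mem_univ _, ?_⟩
    · by_cases hj : l j ≤ 0
      · simp [hx j (not_not.2 hj)]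
      · exact mul_nonneg (not_le.1 hj).le (by positivity)
    · have : 0 < l i := by by_contra h; exact hi (hx i (not_not.2 (not_lt.1 h)))
      positivity

/-! ### Semicontinuity and monotonicity of the negative index. -/

/-- A quadratic form that is negative on the unit sphere of `S` is negative definite on `S`. -/
theorem quadForm_neg_of_sphere {T : (n → ℂ) →ₗ[ℂ] (n → ℂ)} {S : Submodule ℂ (n → ℂ)}
    (h : ∀ x ∈ (S : Set (n → ℂ)) ∩ Metric.sphere 0 1, quadForm T x < 0) :
    ∀ x ∈ S, x ≠ 0 → quadForm T x < 0 := fun x hx h0 => by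
  have hn : 0 < ‖x‖ := norm_pos_iff.2 h0
  have h1 := h ((‖x‖⁻¹ : ℂ) • x) ⟨S.smul_mem _ hx, by simp [norm_smul, hn.ne']⟩
  rw [quadForm_smul] at h1
  have : 0 < ‖(‖x‖⁻¹ : ℂ)‖ ^ 2 := by simp; positivity
  nlinarith

theorem isCompact_submodule_sphere (S : Submodule ℂ (n → ℂ)) :
    IsCompact ((S : Set (n → ℂ)) ∩ Metric.sphere 0 1) :=
  (isCompact_sphere 0 1).inter_left S.closed_of_finiteDimensional

/-- Negative definiteness on a subspace is an open condition. -/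
theorem eventually_forall_neg {X : Type*} [TopologicalSpace X] {x₀ : X}
    {T : X → (n → ℂ) →ₗ[ℂ] (n → ℂ)}
    (hc : ∀ y, ContinuousAt (fun p : X × (n → ℂ) => quadForm (T p.1) p.2) (x₀, y))
    {S : Submodule ℂ (n → ℂ)} (h : ∀ x ∈ S, x ≠ 0 → quadForm (T x₀) x < 0) :
    ∀ᶠ s in 𝓝 x₀, ∀ x ∈ S, x ≠ 0 → quadForm (T s) x < 0 := by
  have := (isCompact_submodule_sphere S).eventually_forall_of_forall_eventually (x₀ := x₀)
    (P := fun s x => quadForm (T s) x < 0) fun x hx => by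
      have h0 : x ≠ 0 := by rintro rfl; simpa using hx.2
      exact (hc x).eventually_lt_const (h x hx.1 h0)
  filter_upwards [this] with s hs
  exact quadForm_neg_of_sphere hs

theorem quadForm_neg_map (T : (n → ℂ) →ₗ[ℂ] (n → ℂ)) (x : n → ℂ) :
    quadForm (-T) x = -quadForm T x := by
  simp [quadForm]

theorem eventually_forall_pos {X : Type*} [TopologicalSpace X] {x₀ : X}
    {T : X → (n → ℂ) →ₗ[ℂ] (n → ℂ)}
    (hc : ∀ y, ContinuousAt (fun p : X × (n → ℂ) => quadForm (T p.1) p.2) (x₀, y))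
    {S : Submodule ℂ (n → ℂ)} (h : ∀ x ∈ S, x ≠ 0 → 0 < quadForm (T x₀) x) :
    ∀ᶠ s in 𝓝 x₀, ∀ x ∈ S, x ≠ 0 → 0 < quadForm (T s) x := by
  have := eventually_forall_neg (x₀ := x₀) (T := fun s => -T s) (S := S)
    (fun y => by simp only [quadForm_neg_map]; exact (hc y).neg)
    (fun x hx h0 => by simpa [quadForm_neg_map] using h x hx h0)
  filter_upwards [this] with s hs x hx h0
  simpa [quadForm_neg_map] using hs x hx h0

/-- A negative definite subspace of maximal dimension remains negative definite under small
perturbations. -/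
theorem eventually_negIndex_le {X : Type*} [TopologicalSpace X] {x₀ : X}
    {T : X → (n → ℂ) →ₗ[ℂ] (n → ℂ)}
    (hc : ∀ y, ContinuousAt (fun p : X × (n → ℂ) => quadForm (T p.1) p.2) (x₀, y)) :
    ∀ᶠ s in 𝓝 x₀, negIndex (quadForm (T x₀)) ≤ negIndex (quadForm (T s)) := by
  obtain ⟨S, hS, hSq⟩ := exists_finrank_eq_negIndex (quadForm (T x₀))
  filter_upwards [eventually_forall_neg hc hSq] with s hs
  exact hS ▸ finrank_le_negIndex hs

/-- A maximal positive definite subspace survives small perturbations, and it bounds by its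
codimension the dimension of any subspace where the perturbed form is nonpositive. -/
theorem eventually_negIndex_add_ker_le {X : Type*} [TopologicalSpace X] {x₀ : X}
    {T : X → (n → ℂ) →ₗ[ℂ] (n → ℂ)} (hT : ∀ s, IsHermitianMap (T s))
    (hc : ∀ y, ContinuousAt (fun p : X × (n → ℂ) => quadForm (T p.1) p.2) (x₀, y)) :
    ∀ᶠ s in 𝓝 x₀, negIndex (quadForm (T s)) + finrank ℂ (LinearMap.ker (T s)) ≤
      negIndex (quadForm (T x₀)) + finrank ℂ (LinearMap.ker (T x₀)) := by
  obtain ⟨Z, P, hZ, hPZ, -, hP⟩ := (hT x₀).exists_inertia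
  filter_upwards [eventually_forall_pos hc hP] with s hs
  obtain ⟨Z', P', hZ', hPZ', hZq', -⟩ := (hT s).exists_inertia
  have : finrank ℂ P + finrank ℂ Z' ≤ Fintype.card n :=
    finrank_add_finrank_le fun x hx hx' => by
      by_contra h0
      exact absurd (hs x hx h0) (not_lt.2 (hZq' x hx'))
  omega

/-- A strict decrease turns the whole nonpositive subspace of `T`, its kernel included, into a
negative definite one. -/
theorem negIndex_add_ker_le {T T' : (n → ℂ) →ₗ[ℂ] (n → ℂ)} (hT : IsHermitianMap T)
    (h : ∀ x, x ≠ 0 → quadForm T' x < quadForm T x) :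
    negIndex (quadForm T) + finrank ℂ (LinearMap.ker T) ≤ negIndex (quadForm T') := by
  obtain ⟨Z, P, hZ, -, hZq, -⟩ := hT.exists_inertia
  rw [← hZ]
  exact finrank_le_negIndex fun x hx h0 => (h x h0).trans_le (hZq x hx)

/-- Along a continuous family of invertible Hermitian maps the negative index is constant. -/
theorem negIndex_eq_of_isPreconnected {X : Type*} [TopologicalSpace X]
    {T : X → (n → ℂ) →ₗ[ℂ] (n → ℂ)} (hT : ∀ s, IsHermitianMap (T s))
    (hc : Continuous fun p : X × (n → ℂ) => quadForm (T p.1) p.2)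
    {I : Set X} (hI : IsPreconnected I) (hk : ∀ s ∈ I, finrank ℂ (LinearMap.ker (T s)) = 0)
    {a b : X} (ha : a ∈ I) (hb : b ∈ I) :
    negIndex (quadForm (T a)) = negIndex (quadForm (T b)) := by
  refine hI.constant (f := fun s => negIndex (quadForm (T s))) (fun s hs => ?_) ha hb
  rw [ContinuousWithinAt, nhds_discrete, tendsto_pure]
  -- With trivial kernel at `s` the two semicontinuity bounds squeeze the index at nearby points to
  -- its value at `s`.
  filter_upwards [nhdsWithin_le_nhds (eventually_negIndex_le (x₀ := s) fun y => hc.continuousAt),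
    nhdsWithin_le_nhds (eventually_negIndex_add_ker_le (x₀ := s) hT fun y => hc.continuousAt)]
    with r h1 h2
  rw [hk s hs] at h2
  omega

/-! ### Counting kernels by jumps of the index. -/

/-- An integer valued function on `[a, b]` that jumps by `k x` immediately after each `x` has
total increase `∑ k` over `[a, b)`. -/
theorem finsum_jumps {a b : ℝ} (hab : a ≤ b) {n k : ℝ → ℕ}
    (hmono : ∀ x ∈ Icc a b, ∀ y ∈ Icc a b, x < y → n x + k x ≤ n y)
    (hupper : ∀ x ∈ Icc a b, ∀ᶠ y in 𝓝 x, n y + k y ≤ n x + k x)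
    (hlower : ∀ x ∈ Icc a b, ∀ᶠ y in 𝓝 x, n x ≤ n y) :
    (Icc a b ∩ Function.support k).Finite ∧
      ∑ᶠ μ ∈ Ico a b, (k μ : ℤ) = (n b : ℤ) - n a := by
  -- Monotonicity and the local bounds force equality near `x`: `n` is constant on either side and
  -- has no other jump there, so jumps are isolated and compactness leaves finitely many.
  have hloc : ∀ x ∈ Icc a b, ∃ δ > 0, ∀ y ∈ Icc a b, |y - x| < δ →
      (x < y → n y = n x + k x ∧ k y = 0) ∧ (y < x → n y = n x ∧ k y = 0) := by
    intro x hx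
    obtain ⟨δ, hδ, h⟩ := Metric.eventually_nhds_iff.1 ((hupper x hx).and (hlower x hx))
    refine ⟨δ, hδ, fun y hy hyx => ?_⟩
    have h1 := h (y := y) (by rwa [Real.dist_eq])
    refine ⟨fun hlt => ?_, fun hlt => ?_⟩
    · have := hmono x hx y hy hlt
      omega
    · have := hmono y hy x hx hlt
      omega
  have hfin : (Icc a b ∩ Function.support k).Finite := by
    refine isCompact_Icc.induction_on (p := fun s => (s ∩ Function.support k).Finite) (by simp)
      (fun s t hst ht => ht.subset (inter_subset_inter_left _ hst))
      (fun s t hs ht => by rw [union_inter_distrib_right]; exact hs.union ht) fun x hx => ?_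
    obtain ⟨δ, hδ, h⟩ := hloc x hx
    refine ⟨Icc a b ∩ Metric.ball x δ, inter_mem_nhdsWithin _ (Metric.ball_mem_nhds x hδ),
      (finite_singleton x).subset ?_⟩
    rintro y ⟨⟨hy, hyx⟩, hyk⟩
    have h1 := h y hy (by rwa [Metric.mem_ball, Real.dist_eq] at hyx)
    rcases lt_trichotomy x y with hlt | rfl | hlt
    · exact absurd (h1.1 hlt).2 hyk
    · rfl
    · exact absurd (h1.2 hlt).2 hyk
  refine ⟨hfin, ?_⟩
  have hsupp : Function.support (fun μ => (k μ : ℤ)) = Function.support k := by ext; simp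
  -- `Φ` collects the jumps in the half-open interval `[a, x)`, so like `n` it registers the jump at
  -- `x` only to the right of `x`. Hence `n - Φ` is locally constant.
  let Φ : ℝ → ℤ := fun x => ∑ᶠ μ ∈ Ico a x, (k μ : ℤ)
  have hleft : ∀ x ∈ Icc a b, ∀ y ∈ Icc a b, x ≤ y → (∀ z ∈ Ico x y, k z = 0) → Φ y = Φ x := by
    intro x hx y hy hxy hz
    refine finsum_mem_inter_support_eq _ _ _ ?_
    ext z
    constructor
    · rintro ⟨⟨h1, h2⟩, h3⟩
      refine ⟨⟨h1, ?_⟩, h3⟩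
      by_contra h
      exact h3 (by simp [hz z ⟨not_lt.1 h, h2⟩])
    · rintro ⟨⟨h1, h2⟩, h3⟩
      exact ⟨⟨h1, h2.trans_le hxy⟩, h3⟩
  have hright : ∀ x ∈ Icc a b, ∀ y ∈ Icc a b, x < y → (∀ z ∈ Ioo x y, k z = 0) →
      Φ y = Φ x + k x := by
    intro x hx y hy hxy hz
    have h1 : Φ y = ∑ᶠ μ ∈ Ico a x ∪ {x}, (k μ : ℤ) := by
      refine finsum_mem_inter_support_eq _ _ _ ?_
      ext z
      constructor
      · rintro ⟨⟨h1, h2⟩, h3⟩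
        refine ⟨?_, h3⟩
        rcases lt_trichotomy x z with h | h | h
        · exact absurd (by simp [hz z ⟨h, h2⟩]) h3
        · exact Or.inr h.symm
        · exact Or.inl ⟨h1, h⟩
      · rintro ⟨⟨h1, h2⟩ | h, h3⟩
        · exact ⟨⟨h1, h2.trans hxy⟩, h3⟩
        · rw [mem_singleton_iff] at h
          subst h
          exact ⟨⟨hx.1, hxy⟩, h3⟩
    rw [h1, finsum_mem_union' (by simp) ?_ ((finite_singleton x).inter_of_left _),
      finsum_mem_singleton]
    rw [hsupp]
    exact hfin.subset (inter_subset_inter_left _ fun z hz => ⟨hz.1, hz.2.le.trans hx.2⟩)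
  have hconst : (n a : ℤ) - Φ a = n b - Φ b := by
    refine isPreconnected_Icc.constant (f := fun x => (n x : ℤ) - Φ x) (fun x hx => ?_)
      (left_mem_Icc.2 hab) (right_mem_Icc.2 hab)
    rw [ContinuousWithinAt, nhds_discrete, tendsto_pure]
    obtain ⟨δ, hδ, h⟩ := hloc x hx
    filter_upwards [inter_mem_nhdsWithin _ (Metric.ball_mem_nhds x hδ)]
    rintro y ⟨hy, hyx⟩
    rw [Metric.mem_ball, Real.dist_eq] at hyx
    rcases lt_trichotomy x y with hlt | rfl | hlt
    · rw [hright x hx y hy hlt fun z hz => ?_, ((h y hy hyx).1 hlt).1]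
      · push_cast; ring
      · refine ((h z ⟨hx.1.trans hz.1.le, hz.2.le.trans hy.2⟩ ?_).1 hz.1).2
        rw [abs_lt] at hyx ⊢
        constructor <;> linarith [hz.1, hz.2]
    · rfl
    · rw [hleft y hy x hx hlt.le fun z hz => ?_, ((h y hy hyx).2 hlt).1]
      refine ((h z ⟨hy.1.trans hz.1, hz.2.le.trans hx.2⟩ ?_).2 hz.2).2
      rw [abs_lt] at hyx ⊢
      constructor <;> linarith [hz.1, hz.2]
  have ha : Φ a = 0 := by simp only [Φ, Ico_self, finsum_mem_empty]
  have hb : ∑ᶠ μ ∈ Ico a b, (k μ : ℤ) = Φ b := rfl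
  rw [hb]
  linarith

/-- For a strictly decreasing continuous family of Hermitian maps the kernels account for the
growth of the negative index. -/
theorem finsum_finrank_ker {T : ℝ → (n → ℂ) →ₗ[ℂ] (n → ℂ)} (hT : ∀ s, IsHermitianMap (T s))
    {a b : ℝ} (hab : a ≤ b)
    (hc : ∀ s ∈ Icc a b, ∀ y,
      ContinuousAt (fun p : ℝ × (n → ℂ) => quadForm (T p.1) p.2) (s, y))
    (hanti : ∀ s ∈ Icc a b, ∀ r ∈ Icc a b, s < r → ∀ x, x ≠ 0 →
      quadForm (T r) x < quadForm (T s) x) :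
    (Icc a b ∩ Function.support fun s => finrank ℂ (LinearMap.ker (T s))).Finite ∧
      ∑ᶠ μ ∈ Ico a b, (finrank ℂ (LinearMap.ker (T μ)) : ℤ) =
        (negIndex (quadForm (T b)) : ℤ) - negIndex (quadForm (T a)) :=
  finsum_jumps hab (fun s hs r hr hsr => negIndex_add_ker_le (hT s) (hanti s hs r hr hsr))
    (fun s hs => eventually_negIndex_add_ker_le hT (hc s hs))
    (fun s hs => eventually_negIndex_le (hc s hs))

/-- Strong attraction along `J`: for large `c` the form `T - c ‖J ·‖²` is nondegenerate if the
restriction `T₀` of `T` to `ker J` is, and it has `m` more negative directions, where `m` is the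
codimension of `ker J`. -/
theorem eventually_negIndex_coupling {m : Type*} [Fintype m] {T₀ : (n → ℂ) →ₗ[ℂ] (n → ℂ)}
    {w : Type*} [Fintype w] {T : ℝ → (w → ℂ) →ₗ[ℂ] (w → ℂ)}
    (hT₀ : IsHermitianMap T₀) (hT : ∀ c, IsHermitianMap (T c))
    (hw : Fintype.card w = Fintype.card n + Fintype.card m)
    {I : (n → ℂ) →ₗ[ℂ] (w → ℂ)} {U : (m → ℂ) →ₗ[ℂ] (w → ℂ)} {q j : (w → ℂ) → ℝ}
    (hI : Function.Injective I) (hU : Function.Injective U)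
    (hq : Continuous q) (hj : Continuous j) (hj0 : ∀ x, 0 ≤ j x)
    (hqT : ∀ c x, quadForm (T c) x = q x - c * j x)
    (hjU : ∀ x y, j (I x + U y) = 0 → y = 0) (hjI : ∀ x, j (I x) = 0)
    (hqI : ∀ x, q (I x) = quadForm T₀ x) (hker : finrank ℂ (LinearMap.ker T₀) = 0) :
    ∀ᶠ c in atTop, finrank ℂ (LinearMap.ker (T c)) = 0 ∧
      negIndex (quadForm (T c)) = negIndex (quadForm T₀) + Fintype.card m := by
  obtain ⟨N, hN, hNq⟩ := exists_finrank_eq_negIndex (quadForm T₀)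
  obtain ⟨Z, P, hZ, hPZ, -, hP⟩ := hT₀.exists_inertia
  have hdisj : Disjoint (N.map I) (LinearMap.range U) := by
    rw [Submodule.disjoint_def]
    rintro _ ⟨x, hx, rfl⟩ ⟨y, hy⟩
    have h1 := hjU x (-y) (by rw [map_neg, hy, add_neg_cancel]; simpa using hjI 0)
    rw [neg_eq_zero] at h1
    rw [← hy, h1, map_zero]
  have hdim : finrank ℂ ↥(N.map I ⊔ LinearMap.range U) =
      negIndex (quadForm T₀) + Fintype.card m := by
    have h1 := Submodule.finrank_sup_add_finrank_inf_eq (N.map I) (LinearMap.range U)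
    rw [hdisj.eq_bot, finrank_bot, add_zero, LinearMap.finrank_range_of_inj hU,
      (Submodule.equivMapOfInjective I hI N).finrank_eq.symm] at h1
    rw [h1, hN]
    simp
  have hnegev : ∀ᶠ c in atTop, ∀ x ∈ (↑(N.map I ⊔ LinearMap.range U) : Set (w → ℂ)) ∩
      Metric.sphere 0 1, quadForm (T c) x < 0 := by
    -- On this sphere either `j > 0`, and the penalty `c * j` wins for large `c`, or the vector lies
    -- in the image of `N`, where `q < 0` persists nearby for every `c ≥ 0`. Compactness gives one
    -- `c` for the whole sphere.
    have hK := isCompact_submodule_sphere (N.map I ⊔ LinearMap.range U)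
    have key := hK.mem_prod_nhdsSet_of_forall (l := (atTop : Filter ℝ))
      (s := {p : ℝ × (w → ℂ) | quadForm (T p.1) p.2 < 0}) ?_
    · exact (Filter.Eventually.curry (p := fun p : ℝ × (w → ℂ) => quadForm (T p.1) p.2 < 0)
        key).mono fun c h => h.self_of_nhdsSet
    · rintro x ⟨hx, hx1⟩
      have h0 : x ≠ 0 := by rintro rfl; simp at hx1
      obtain ⟨_, ⟨y, hy, rfl⟩, _, ⟨z, rfl⟩, rfl⟩ := Submodule.mem_sup.1 hx
      by_cases hjx : j (I y + U z) = 0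
      · have hz := hjU y z hjx
        subst hz
        rw [map_zero, add_zero] at *
        have hy0 : y ≠ 0 := by rintro rfl; simp at h0
        have h1 : ∀ᶠ x in 𝓝 (I y), q x < 0 :=
          hq.continuousAt.eventually_lt_const (by rw [hqI]; exact hNq y hy hy0)
        filter_upwards [(eventually_ge_atTop (0 : ℝ)).prod_mk h1]
        rintro ⟨c, x⟩ ⟨hc, hx⟩
        have := mul_nonneg hc (hj0 x)
        simp only [hqT]
        simp only at hx
        linarith
      · have hjp : 0 < j (I y + U z) := lt_of_le_of_ne (hj0 _) (Ne.symm hjx)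
        have h1 : ∀ᶠ x in 𝓝 (I y + U z), j (I y + U z) / 2 < j x :=
          hj.continuousAt.eventually_const_lt (half_lt_self hjp)
        have h2 : ∀ᶠ x in 𝓝 (I y + U z), q x < |q (I y + U z)| + 1 :=
          hq.continuousAt.eventually_lt_const (by linarith [le_abs_self (q (I y + U z))])
        -- Beyond this threshold `c` times half of the value of `j` at the centre exceeds the local
        -- upper bound for `q`.
        filter_upwards [(eventually_ge_atTop
          ((|q (I y + U z)| + 1) / (j (I y + U z) / 2))).prod_mk (h1.and h2)]
        rintro ⟨c, x⟩ ⟨hc, hx1, hx2⟩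
        simp only [hqT]
        simp only at hc hx1 hx2
        rw [div_le_iff₀ (half_pos hjp)] at hc
        have hc0 : 0 ≤ c := by
          by_contra h
          have := mul_neg_of_neg_of_pos (not_le.1 h) (half_pos hjp)
          linarith [abs_nonneg (q (I y + U z))]
        nlinarith
  filter_upwards [hnegev] with c hc
  have h1 := finrank_le_negIndex (quadForm_neg_of_sphere hc)
  obtain ⟨Z', P', hZ', hPZ', hZq', -⟩ := (hT c).exists_inertia
  -- Since `j` vanishes on the image of `I`, the positive subspace `P` of `T₀` stays positive for
  -- every `c`. This bounds index plus nullity from above by the lower bound `h1` for the index, so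
  -- both conclusions follow by counting dimensions.
  have h2 : finrank ℂ (P.map I) + finrank ℂ Z' ≤ Fintype.card w :=
    finrank_add_finrank_le fun x hx hx' => by
      obtain ⟨y, hy, rfl⟩ := hx
      by_contra h0
      have hy0 : y ≠ 0 := by rintro rfl; simp at h0
      have := hZq' _ hx'
      rw [hqT, hjI, hqI] at this
      linarith [hP y hy hy0]
  rw [(Submodule.equivMapOfInjective I hI P).finrank_eq.symm] at h2
  omega

end Index

/-! ### The fundamental system of `u'' = -μ u` -/

section Modes

open Filter Topology

/-- The solution of `u'' = -μ u` with `u 0 = 1` and `u' 0 = 0`. One of the two factors is `1`. -/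
def modeC (μ x : ℝ) : ℝ := Real.cos (√μ * x) * Real.cosh (√(-μ) * x)

/-- The solution of `u'' = -μ u` with `u 0 = 0` and `u' 0 = 1`. -/
def modeS (μ x : ℝ) : ℝ := ∫ y in (0 : ℝ)..x, modeC μ y

theorem continuous_modeC : Continuous fun p : ℝ × ℝ => modeC p.1 p.2 := by
  unfold modeC
  fun_prop

theorem continuous_modeC_right (μ : ℝ) : Continuous (modeC μ) :=
  continuous_modeC.comp (Continuous.prodMk_right μ)

theorem continuous_modeC_left (x : ℝ) : Continuous fun μ => modeC μ x :=
  continuous_modeC.comp (Continuous.prodMk_left x)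

theorem continuous_modeS_left (x : ℝ) : Continuous fun μ => modeS μ x :=
  intervalIntegral.continuous_parametric_intervalIntegral_of_continuous' continuous_modeC 0 x

@[simp] theorem modeC_zero_right (μ : ℝ) : modeC μ 0 = 1 := by simp [modeC]

@[simp] theorem modeS_zero_right (μ : ℝ) : modeS μ 0 = 0 := by simp [modeS]

@[simp] theorem modeC_zero_left (x : ℝ) : modeC 0 x = 1 := by simp [modeC]

@[simp] theorem modeS_zero_left (x : ℝ) : modeS 0 x = x := by simp [modeS]

theorem hasDerivAt_modeS (μ x : ℝ) : HasDerivAt (modeS μ) (modeC μ x) x :=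
  (continuous_modeC_right μ).integral_hasStrictDerivAt 0 x |>.hasDerivAt

theorem continuous_modeS_right (μ : ℝ) : Continuous (modeS μ) :=
  continuous_iff_continuousAt.2 fun x => (hasDerivAt_modeS μ x).continuousAt

/-- `Real.sqrt` vanishes on nonpositive numbers, so for either sign of `μ` only the trigonometric or
only the hyperbolic factor is present. Defining `modeS` as an integral gives its continuity in `μ`
across zero without dividing by `√μ`; here the integral is evaluated. -/
theorem hasDerivAt_modeC (μ x : ℝ) : HasDerivAt (modeC μ) (-μ * modeS μ x) x := by
  have hc : ∀ x, HasDerivAt (modeC μ) (-Real.sin (√μ * x) * √μ * Real.cosh (√(-μ) * x) +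
      Real.cos (√μ * x) * (Real.sinh (√(-μ) * x) * √(-μ))) x := fun x => by
    have h1 : HasDerivAt (fun x => √μ * x) √μ x := by simpa using (hasDerivAt_id x).const_mul √μ
    have h2 : HasDerivAt (fun x => √(-μ) * x) √(-μ) x := by
      simpa using (hasDerivAt_id x).const_mul √(-μ)
    exact h1.cos.mul h2.cosh
  have key : -Real.sin (√μ * x) * √μ * Real.cosh (√(-μ) * x) +
      Real.cos (√μ * x) * (Real.sinh (√(-μ) * x) * √(-μ)) = -μ * modeS μ x := by
    rcases le_total 0 μ with h | h
    · have h0 : √(-μ) = 0 := Real.sqrt_eq_zero_of_nonpos (by linarith)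
      have hd : ∀ y, HasDerivAt (fun y => Real.sin (√μ * y)) (√μ * modeC μ y) y := fun y => by
        have h1 : HasDerivAt (fun x => √μ * x) √μ y := by
          simpa using (hasDerivAt_id y).const_mul √μ
        convert h1.sin using 1
        simp [modeC, h0, mul_comm]
      have hi := intervalIntegral.integral_eq_sub_of_hasDerivAt (a := 0) (b := x)
        (fun y _ => hd y)
        ((continuous_const.mul (continuous_modeC_right μ)).intervalIntegrable _ _)
      rw [intervalIntegral.integral_const_mul] at hi
      simp only [mul_zero, Real.sin_zero, sub_zero] at hi
      rw [h0, ← hi, modeS]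
      simp only [zero_mul, Real.cosh_zero, mul_zero, add_zero, mul_one]
      linear_combination (-(∫ y in (0 : ℝ)..x, modeC μ y)) * Real.mul_self_sqrt h
    · have h0 : √μ = 0 := Real.sqrt_eq_zero_of_nonpos h
      have hd : ∀ y, HasDerivAt (fun y => Real.sinh (√(-μ) * y)) (√(-μ) * modeC μ y) y :=
        fun y => by
          have h1 : HasDerivAt (fun x => √(-μ) * x) √(-μ) y := by
            simpa using (hasDerivAt_id y).const_mul √(-μ)
          convert h1.sinh using 1
          simp [modeC, h0, mul_comm]
      have hi := intervalIntegral.integral_eq_sub_of_hasDerivAt (a := 0) (b := x)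
        (fun y _ => hd y)
        ((continuous_const.mul (continuous_modeC_right μ)).intervalIntegrable _ _)
      rw [intervalIntegral.integral_const_mul] at hi
      simp only [mul_zero, Real.sinh_zero, sub_zero] at hi
      rw [h0, ← hi, modeS]
      simp only [zero_mul, Real.sin_zero, Real.cos_zero, mul_zero, zero_add, one_mul, neg_zero]
      linear_combination (∫ y in (0 : ℝ)..x, modeC μ y) *
        Real.mul_self_sqrt (show 0 ≤ -μ by linarith)
  rw [← key]
  exact hc x

/-- Conservation of energy for the solution `modeS μ`. -/
theorem modeC_sq_add (μ x : ℝ) : modeC μ x ^ 2 + μ * modeS μ x ^ 2 = 1 := by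
  have hd : ∀ y, HasDerivAt (fun y => modeC μ y ^ 2 + μ * modeS μ y ^ 2) 0 y := fun y => by
    refine (((hasDerivAt_modeC μ y).pow 2).add
      (((hasDerivAt_modeS μ y).pow 2).const_mul μ)).congr_deriv ?_
    ring
  have := is_const_of_deriv_eq_zero (fun y => (hd y).differentiableAt) (fun y => (hd y).deriv) x 0
  simpa using this

/-- Solutions of the system `u' = v`, `v' = -μ u` are determined by their initial values. -/
theorem ode_unique {μ ℓ : ℝ} {u v : ℝ → ℂ}
    (hu : ∀ x ∈ Icc 0 ℓ, HasDerivWithinAt u (v x) (Icc 0 ℓ) x)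
    (hv : ∀ x ∈ Icc 0 ℓ, HasDerivWithinAt v (-μ * u x) (Icc 0 ℓ) x) {x : ℝ} (hx : x ∈ Icc 0 ℓ) :
    u x = u 0 * modeC μ x + v 0 * modeS μ x ∧ v x = v 0 * modeC μ x - μ * u 0 * modeS μ x := by
  have hC : ∀ y, HasDerivWithinAt (fun y => (modeC μ y : ℂ)) (-μ * modeS μ y) (Icc 0 ℓ) y :=
    fun y => by
      have := (hasDerivAt_modeC μ y).ofReal_comp.hasDerivWithinAt (s := Icc 0 ℓ)
      push_cast at this
      exact this
  have hS : ∀ y, HasDerivWithinAt (fun y => (modeS μ y : ℂ)) (modeC μ y) (Icc 0 ℓ) y :=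
    fun y => (hasDerivAt_modeS μ y).ofReal_comp.hasDerivWithinAt
  have hconst : ∀ {F : ℝ → ℂ}, (∀ y ∈ Icc 0 ℓ, HasDerivWithinAt F 0 (Icc 0 ℓ) y) → F x = F 0 :=
    fun {F} hF => constant_of_has_deriv_right_zero (fun y hy => (hF y hy).continuousWithinAt)
      (fun y hy => (hF y (Ico_subset_Icc_self hy)).mono_of_mem_nhdsWithin
        (Icc_mem_nhdsGE_of_mem hy)) x hx
  -- Two Wronskian combinations of the solution with the modes are constant. They form a linear
  -- system for `u x` and `v x` with determinant `modeC ^ 2 + μ * modeS ^ 2 = 1`.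
  have h1 := hconst (F := fun y => u y * modeC μ y - v y * modeS μ y) fun y hy => by
    refine (((hu y hy).mul (hC y)).sub ((hv y hy).mul (hS y))).congr_deriv ?_
    ring
  have h2 := hconst (F := fun y => u y * (μ * modeS μ y) + v y * modeC μ y) fun y hy => by
    refine (((hu y hy).mul ((hS y).const_mul (μ : ℂ))).add
      ((hv y hy).mul (hC y))).congr_deriv ?_
    ring
  simp only [modeC_zero_right, modeS_zero_right, Complex.ofReal_one, Complex.ofReal_zero, mul_one,
    mul_zero, sub_zero, zero_add] at h1 h2
  have h3 : (modeC μ x : ℂ) ^ 2 + μ * (modeS μ x : ℂ) ^ 2 = 1 := by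
    exact_mod_cast congrArg Complex.ofReal (modeC_sq_add μ x)
  constructor
  · linear_combination (modeC μ x : ℂ) * h1 + (modeS μ x : ℂ) * h2 - u x * h3
  · linear_combination (modeC μ x : ℂ) * h2 - μ * (modeS μ x : ℂ) * h1 - v x * h3

/-- The doubling formulas follow from uniqueness: `2 S(y/2) C(y/2)` solves the same equation with
the initial data of `modeS`. They allow an edge to be analysed from its midpoint. -/
theorem mode_two_mul (μ : ℝ) {x : ℝ} (hx : 0 ≤ x) :
    modeC μ (2 * x) = modeC μ x ^ 2 - μ * modeS μ x ^ 2 ∧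
      modeS μ (2 * x) = 2 * modeS μ x * modeC μ x := by
  have hh : ∀ y : ℝ, HasDerivAt (fun y : ℝ => y / 2) (1 / 2) y := fun y =>
    (hasDerivAt_id y).div_const 2
  have hC : ∀ y : ℝ, HasDerivAt (fun y => modeC μ (y / 2)) (-μ * modeS μ (y / 2) * (1 / 2)) y :=
    fun y => HasDerivAt.comp (h₂ := modeC μ) (h := fun y => y / 2) y
      (hasDerivAt_modeC μ (y / 2)) (hh y)
  have hS : ∀ y : ℝ, HasDerivAt (fun y => modeS μ (y / 2)) (modeC μ (y / 2) * (1 / 2)) y :=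
    fun y => HasDerivAt.comp (h₂ := modeS μ) (h := fun y => y / 2) y
      (hasDerivAt_modeS μ (y / 2)) (hh y)
  have key := ode_unique (μ := μ) (ℓ := 2 * x)
    (u := fun y => ((2 * modeS μ (y / 2) * modeC μ (y / 2) : ℝ) : ℂ))
    (v := fun y => ((modeC μ (y / 2) ^ 2 - μ * modeS μ (y / 2) ^ 2 : ℝ) : ℂ))
    (fun y _ => by
      have := (((hS y).const_mul 2).mul (hC y)).ofReal_comp.hasDerivWithinAt (s := Icc 0 (2 * x))
      refine this.congr_deriv ?_
      push_cast
      ring)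
    (fun y _ => by
      have := (((hC y).pow 2).sub (((hS y).pow 2).const_mul μ)).ofReal_comp.hasDerivWithinAt
        (s := Icc 0 (2 * x))
      refine this.congr_deriv ?_
      push_cast
      ring) (x := 2 * x) ⟨by linarith, le_rfl⟩
  simp only [mul_div_cancel_left₀ x (two_ne_zero' ℝ), zero_div, modeS_zero_right,
    modeC_zero_right] at key
  norm_num at key
  exact ⟨by exact_mod_cast key.2.symm, Complex.ofReal_injective (by push_cast; exact key.1.symm)⟩

theorem modeC_pos {μ x : ℝ} (hx : 0 ≤ x) (h : √μ * x < Real.pi / 2) : 0 < modeC μ x :=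
  mul_pos (Real.cos_pos_of_mem_Ioo
    ⟨by have := mul_nonneg (Real.sqrt_nonneg μ) hx; linarith [Real.pi_pos], h⟩) (Real.cosh_pos _)

theorem modeS_pos {μ x : ℝ} (hx : 0 < x) (h : √μ * x < Real.pi / 2) : 0 < modeS μ x := by
  refine intervalIntegral.intervalIntegral_pos_of_pos_on
    ((continuous_modeC_right μ).intervalIntegrable _ _) (fun y hy => modeC_pos hy.1.le ?_) hx
  exact (mul_le_mul_of_nonneg_left hy.2.le (Real.sqrt_nonneg μ)).trans_lt h

/-! ### Monotonicity of the boundary form of an edge. -/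

/-- Sturm comparison of two positive solutions by means of their Wronskian. -/
theorem wronskian_pos {μ ν h : ℝ} (hμν : μ < ν) (hh : 0 < h) {u u' v v' : ℝ → ℝ}
    (hu : ∀ x, HasDerivAt u (u' x) x) (hu' : ∀ x, HasDerivAt u' (-μ * u x) x)
    (hv : ∀ x, HasDerivAt v (v' x) x) (hv' : ∀ x, HasDerivAt v' (-ν * v x) x)
    (h0 : u' 0 * v 0 - u 0 * v' 0 = 0) (hpos : ∀ x ∈ Ioo 0 h, 0 < u x ∧ 0 < v x) :
    u h * v' h < u' h * v h := by
  have hd : ∀ x, HasDerivAt (fun x => u' x * v x - u x * v' x) ((ν - μ) * (u x * v x)) x :=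
    fun x => by
      refine (((hu' x).mul (hv x)).sub ((hu x).mul (hv' x))).congr_deriv ?_
      ring
  have hmono : StrictMonoOn (fun x => u' x * v x - u x * v' x) (Icc 0 h) := by
    refine strictMonoOn_of_deriv_pos (convex_Icc 0 h)
      (fun x _ => (hd x).continuousAt.continuousWithinAt) fun x hx => ?_
    rw [interior_Icc] at hx
    rw [(hd x).deriv]
    exact mul_pos (by linarith) (mul_pos (hpos x hx).1 (hpos x hx).2)
  have := hmono (left_mem_Icc.2 hh.le) (right_mem_Icc.2 hh.le) hh
  simp only [h0] at this
  linarith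

/-- The quadratic form `u' ū` at the ends of an edge of length `ℓ` for the solution `u` of
`u'' = -μ u` with boundary values `a`, `b`. -/
def edgeForm (μ ℓ : ℝ) (a b : ℂ) : ℝ :=
  (modeC μ ℓ * (‖a‖ ^ 2 + ‖b‖ ^ 2) - 2 * (star a * b).re) / modeS μ ℓ

/-- Splitting a solution into its odd and even parts about the midpoint diagonalizes the form. The
coefficients are the logarithmic derivatives of `modeS` and `modeC` at half the length. -/
theorem edgeForm_eq {μ ℓ : ℝ} (hℓ : 0 < ℓ) (h : √μ * ℓ < Real.pi / 2) (a b : ℂ) :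
    edgeForm μ ℓ a b = (modeC μ (ℓ / 2) / modeS μ (ℓ / 2) * ‖a - b‖ ^ 2 +
      -μ * modeS μ (ℓ / 2) / modeC μ (ℓ / 2) * ‖a + b‖ ^ 2) / 2 := by
  obtain ⟨hC, hS⟩ := mode_two_mul μ (half_pos hℓ).le
  rw [mul_div_cancel₀ ℓ (two_ne_zero' ℝ)] at hC hS
  have hh : √μ * (ℓ / 2) < Real.pi / 2 :=
    (mul_le_mul_of_nonneg_left (by linarith) (Real.sqrt_nonneg μ)).trans_lt h
  have hc := modeC_pos (half_pos hℓ).le hh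
  have hs := modeS_pos (half_pos hℓ) hh
  have h1 := modeC_sq_add μ (ℓ / 2)
  rw [edgeForm, hC, hS]
  have e1 : ‖a - b‖ ^ 2 = ‖a‖ ^ 2 + ‖b‖ ^ 2 - 2 * (star a * b).re := by
    rw [Complex.sq_norm, Complex.sq_norm, Complex.sq_norm, Complex.normSq_apply,
      Complex.normSq_apply, Complex.normSq_apply]
    simp
    ring
  have e2 : ‖a + b‖ ^ 2 = ‖a‖ ^ 2 + ‖b‖ ^ 2 + 2 * (star a * b).re := by
    rw [Complex.sq_norm, Complex.sq_norm, Complex.sq_norm, Complex.normSq_apply,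
      Complex.normSq_apply, Complex.normSq_apply]
    simp
    ring
  rw [e1, e2]
  field_simp
  linear_combination (2 * (star a * b).re) * h1

/-- Both logarithmic derivatives strictly decrease in `μ` by Sturm comparison, as the modes stay
positive up to the midpoint; `a - b` and `a + b` do not both vanish. -/
theorem edgeForm_strictAnti {μ ν ℓ : ℝ} (hμν : μ < ν) (hℓ : 0 < ℓ) (h : √ν * ℓ < Real.pi / 2)
    {a b : ℂ} (hab : a ≠ 0 ∨ b ≠ 0) : edgeForm ν ℓ a b < edgeForm μ ℓ a b := by
  have hμ : √μ * ℓ < Real.pi / 2 :=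
    (mul_le_mul_of_nonneg_right (Real.sqrt_le_sqrt hμν.le) hℓ.le).trans_lt h
  have hhalf : ∀ {κ : ℝ}, √κ * ℓ < Real.pi / 2 → ∀ {x : ℝ}, x ≤ ℓ / 2 →
      √κ * x < Real.pi / 2 := fun hκ x hx =>
    (mul_le_mul_of_nonneg_left (by linarith) (Real.sqrt_nonneg _)).trans_lt hκ
  have hℓ2 := half_pos hℓ
  rw [edgeForm_eq hℓ h, edgeForm_eq hℓ hμ]
  have hcμ := modeC_pos hℓ2.le (hhalf hμ le_rfl)
  have hcν := modeC_pos hℓ2.le (hhalf h le_rfl)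
  have hsμ := modeS_pos hℓ2 (hhalf hμ le_rfl)
  have hsν := modeS_pos hℓ2 (hhalf h le_rfl)
  have h1 : modeC ν (ℓ / 2) / modeS ν (ℓ / 2) < modeC μ (ℓ / 2) / modeS μ (ℓ / 2) := by
    rw [div_lt_div_iff₀ hsν hsμ]
    have := wronskian_pos hμν hℓ2 (hasDerivAt_modeS μ) (hasDerivAt_modeC μ) (hasDerivAt_modeS ν)
      (hasDerivAt_modeC ν) (by simp) fun x hx =>
        ⟨modeS_pos hx.1 (hhalf hμ hx.2.le), modeS_pos hx.1 (hhalf h hx.2.le)⟩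
    linarith
  have h2 : -ν * modeS ν (ℓ / 2) / modeC ν (ℓ / 2) < -μ * modeS μ (ℓ / 2) / modeC μ (ℓ / 2) := by
    rw [div_lt_div_iff₀ hcν hcμ]
    have := wronskian_pos hμν hℓ2 (hasDerivAt_modeC μ)
      (fun x => (hasDerivAt_modeS μ x).const_mul (-μ)) (hasDerivAt_modeC ν)
      (fun x => (hasDerivAt_modeS ν x).const_mul (-ν)) (by simp) fun x hx =>
        ⟨modeC_pos hx.1.le (hhalf hμ hx.2.le), modeC_pos hx.1.le (hhalf h hx.2.le)⟩
    linarith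
  have hne : 0 < ‖a - b‖ ^ 2 ∨ 0 < ‖a + b‖ ^ 2 := by
    by_contra! hcon
    have h3 : a - b = 0 := by simpa using le_antisymm hcon.1 (by positivity)
    have h4 : a + b = 0 := by simpa using le_antisymm hcon.2 (by positivity)
    have ha : a = 0 := by linear_combination (h3 + h4) / 2
    have hb : b = 0 := by linear_combination (h4 - h3) / 2
    simp [ha, hb] at hab
  have h3 : 0 ≤ ‖a - b‖ ^ 2 := by positivity
  have h4 : 0 ≤ ‖a + b‖ ^ 2 := by positivity
  rcases hne with h5 | h5
  · linarith [mul_lt_mul_of_pos_right h1 h5, mul_le_mul_of_nonneg_right h2.le h4]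
  · linarith [mul_le_mul_of_nonneg_right h1.le h3, mul_lt_mul_of_pos_right h2 h5]

theorem continuousAt_edgeForm {μ ℓ : ℝ} (hS : modeS μ ℓ ≠ 0) (p : ℂ × ℂ) :
    ContinuousAt (fun q : ℝ × ℂ × ℂ => edgeForm q.1 ℓ q.2.1 q.2.2) (μ, p) := by
  have h1 := continuous_modeC_left ℓ
  have h2 := continuous_modeS_left ℓ
  unfold edgeForm
  refine ContinuousAt.div (Continuous.continuousAt ?_) (Continuous.continuousAt ?_) hS
  · fun_prop
  · fun_prop

theorem edgeForm_zero (ℓ : ℝ) (a b : ℂ) : edgeForm 0 ℓ a b = ‖b - a‖ ^ 2 / ℓ := by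
  simp only [edgeForm, modeC_zero_left, modeS_zero_left, Complex.sq_norm, Complex.normSq_apply]
  simp
  ring

end Modes

/-! ### The Dirichlet-to-Neumann map of a metric graph -/

section DirichletToNeumann

open Module Filter Topology

variable {W E : Type*} [Fintype E]

open Classical in
/-- The sum at `v` of the derivatives directed out of the edges, `p e` and `q e` being the
derivatives at the beginning and at the end of `e` in the direction of `e`. -/
def normalSum (src tgt : E → W) (p q : E → ℂ) (v : W) : ℂ :=
  (∑ e with tgt e = v, q e) - ∑ e with src e = v, p e

variable (src tgt : E → W) (ℓ : E → ℝ)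

/-- The derivative at the beginning of an edge of length `ℓ` of the solution of `u'' = -μ u` with
boundary values `a` and `b`. -/
def startSlope (μ ℓ : ℝ) (a b : ℂ) : ℂ := (b - modeC μ ℓ * a) / modeS μ ℓ

/-- The derivative at the end of an edge of length `ℓ` of the solution of `u'' = -μ u` with
boundary values `a` and `b`. -/
def endSlope (μ ℓ : ℝ) (a b : ℂ) : ℂ := (modeC μ ℓ * b - a) / modeS μ ℓ

/-- The Dirichlet-to-Neumann map of `-d²/dx² - μ`. -/
def dtn (μ : ℝ) : (W → ℂ) →ₗ[ℂ] (W → ℂ) where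
  toFun φ := normalSum src tgt (fun e => startSlope μ (ℓ e) (φ (src e)) (φ (tgt e)))
    fun e => endSlope μ (ℓ e) (φ (src e)) (φ (tgt e))
  map_add' φ ψ := by
    ext v
    simp only [normalSum, startSlope, endSlope, Pi.add_apply]
    rw [sub_add_sub_comm, ← Finset.sum_add_distrib, ← Finset.sum_add_distrib]
    congr 1 <;> exact Finset.sum_congr rfl fun e _ => by ring
  map_smul' c φ := by
    ext v
    simp only [normalSum, startSlope, endSlope, Pi.smul_apply, smul_eq_mul, RingHom.id_apply]
    rw [mul_sub, Finset.mul_sum, Finset.mul_sum]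
    congr 1 <;> exact Finset.sum_congr rfl fun e _ => by ring

theorem dtn_apply (μ : ℝ) (φ : W → ℂ) : dtn src tgt ℓ μ φ =
    normalSum src tgt (fun e => startSlope μ (ℓ e) (φ (src e)) (φ (tgt e)))
      fun e => endSlope μ (ℓ e) (φ (src e)) (φ (tgt e)) := rfl

theorem dotProduct_normalSum [Fintype W] (ξ : W → ℂ) (p q : E → ℂ) :
    ξ ⬝ᵥ normalSum src tgt p q = ∑ e, (ξ (tgt e) * q e - ξ (src e) * p e) := by
  classical
  have key : ∀ (f : E → W) (r : E → ℂ), ∑ v, ξ v * ∑ e with f e = v, r e =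
      ∑ e, ξ (f e) * r e := fun f r => by
    rw [← Finset.sum_fiberwise Finset.univ f (fun e => ξ (f e) * r e)]
    refine Finset.sum_congr rfl fun v _ => ?_
    rw [Finset.mul_sum]
    refine Finset.sum_congr rfl fun e he => ?_
    rw [(Finset.mem_filter.1 he).2]
  rw [Finset.sum_sub_distrib, ← key, ← key, ← Finset.sum_sub_distrib]
  refine Finset.sum_congr rfl fun v _ => ?_
  rw [normalSum, mul_sub]

theorem star_dotProduct_dtn [Fintype W] (μ : ℝ) (ξ φ : W → ℂ) :
    star ξ ⬝ᵥ dtn src tgt ℓ μ φ =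
      ∑ e, (star (ξ (tgt e)) * endSlope μ (ℓ e) (φ (src e)) (φ (tgt e)) -
        star (ξ (src e)) * startSlope μ (ℓ e) (φ (src e)) (φ (tgt e))) :=
  dotProduct_normalSum src tgt (star ξ) _ _

theorem isHermitianMap_dtn [Fintype W] (μ : ℝ) : IsHermitianMap (dtn src tgt ℓ μ) := by
  intro x y
  have h : star (dtn src tgt ℓ μ x) ⬝ᵥ y = star (star y ⬝ᵥ dtn src tgt ℓ μ x) :=
    Matrix.star_dotProduct _ _
  rw [h, star_dotProduct_dtn, star_dotProduct_dtn, star_sum]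
  refine Finset.sum_congr rfl fun e _ => ?_
  simp only [startSlope, endSlope, star_sub, star_mul', star_div₀,
    RCLike.star_def, Complex.conj_ofReal, starRingEnd_self_apply]
  ring

theorem quadForm_dtn [Fintype W] (μ : ℝ) (φ : W → ℂ) :
    quadForm (dtn src tgt ℓ μ) φ = ∑ e, edgeForm μ (ℓ e) (φ (src e)) (φ (tgt e)) := by
  rw [quadForm, star_dotProduct_dtn, Complex.re_sum]
  refine Finset.sum_congr rfl fun e _ => ?_
  generalize φ (src e) = a
  generalize φ (tgt e) = b
  have h1 : ∀ z : ℂ, star z * z = ((‖z‖ ^ 2 : ℝ) : ℂ) := fun z => by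
    simpa using Complex.conj_mul' z
  have h2 : (star b * a).re = (star a * b).re := by simp [mul_comm]
  have h3 : star b * endSlope μ (ℓ e) a b - star a * startSlope μ (ℓ e) a b =
      (((modeC μ (ℓ e) * (‖a‖ ^ 2 + ‖b‖ ^ 2) : ℝ) : ℂ) - (star b * a + star a * b)) /
        ((modeS μ (ℓ e) : ℝ) : ℂ) := by
    rw [mul_add, Complex.ofReal_add, Complex.ofReal_mul, Complex.ofReal_mul, ← h1, ← h1, startSlope,
      endSlope]
    ring
  rw [h3, Complex.div_ofReal_re, Complex.sub_re, Complex.ofReal_re, Complex.add_re, h2, edgeForm]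
  ring

theorem IsHermitianMap.sub_smul [Fintype W] {T K : (W → ℂ) →ₗ[ℂ] (W → ℂ)} (hT : IsHermitianMap T)
    (hK : IsHermitianMap K) (c : ℝ) : IsHermitianMap (T - (c : ℂ) • K) := fun x y => by
  simp only [LinearMap.sub_apply, LinearMap.smul_apply, star_sub, star_smul, sub_dotProduct,
    dotProduct_sub, dotProduct_smul, smul_dotProduct, hT x y, hK x y]
  simp

theorem quadForm_sub_smul [Fintype W] (T K : (W → ℂ) →ₗ[ℂ] (W → ℂ)) (c : ℝ) (x : W → ℂ) :
    quadForm (T - (c : ℂ) • K) x = quadForm T x - c * quadForm K x := by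
  simp [quadForm, dotProduct_sub, dotProduct_smul]

theorem continuous_quadForm [Fintype W] (T : (W → ℂ) →ₗ[ℂ] (W → ℂ)) : Continuous (quadForm T) := by
  have : Continuous T := T.continuous_of_finiteDimensional
  unfold quadForm dotProduct
  fun_prop

variable {src tgt ℓ}

theorem quadForm_dtn_strictAnti [Fintype W] (hℓ : ∀ e, 0 < ℓ e)
    (hends : ∀ v, ∃ e, src e = v ∨ tgt e = v) {μ ν : ℝ} (hμν : μ < ν)
    (h : ∀ e, √ν * ℓ e < Real.pi / 2) {φ : W → ℂ} (hφ : φ ≠ 0) :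
    quadForm (dtn src tgt ℓ ν) φ < quadForm (dtn src tgt ℓ μ) φ := by
  obtain ⟨v, hv⟩ := Function.ne_iff.1 hφ
  rw [Pi.zero_apply] at hv
  obtain ⟨e, he⟩ := hends v
  rw [quadForm_dtn, quadForm_dtn]
  refine Finset.sum_lt_sum (fun e _ => ?_) ⟨e, Finset.mem_univ _, ?_⟩
  · by_cases h0 : φ (src e) ≠ 0 ∨ φ (tgt e) ≠ 0
    · exact (edgeForm_strictAnti hμν (hℓ e) (h e) h0).le
    · push Not at h0
      simp [edgeForm, h0.1, h0.2]
  · refine edgeForm_strictAnti hμν (hℓ e) (h e) ?_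
    rcases he with rfl | rfl
    · exact Or.inl hv
    · exact Or.inr hv

theorem continuousAt_quadForm_dtn [Fintype W] (hℓ : ∀ e, 0 < ℓ e) {μ : ℝ}
    (h : ∀ e, √μ * ℓ e < Real.pi / 2) (φ : W → ℂ) :
    ContinuousAt (fun p : ℝ × (W → ℂ) => quadForm (dtn src tgt ℓ p.1) p.2) (μ, φ) := by
  simp only [quadForm_dtn]
  refine tendsto_finsetSum _ fun e _ => ?_
  have h1 : ContinuousAt (fun p : ℝ × (W → ℂ) => (p.1, p.2 (src e), p.2 (tgt e))) (μ, φ) :=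
    Continuous.continuousAt (by fun_prop)
  exact ContinuousAt.comp (x := (μ, φ))
    (f := fun p : ℝ × (W → ℂ) => (p.1, p.2 (src e), p.2 (tgt e)))
    (continuousAt_edgeForm (modeS_pos (hℓ e) (h e)).ne' _) h1

theorem quadForm_dtn_zero_nonneg [Fintype W] (hℓ : ∀ e, 0 < ℓ e) (φ : W → ℂ) :
    0 ≤ quadForm (dtn src tgt ℓ 0) φ := by
  rw [quadForm_dtn]
  refine Finset.sum_nonneg fun e _ => ?_
  rw [edgeForm_zero]
  have := hℓ e
  positivity

theorem negIndex_dtn_zero [Fintype W] (hℓ : ∀ e, 0 < ℓ e) :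
    negIndex (quadForm (dtn src tgt ℓ 0)) = 0 := by
  obtain ⟨S, hS, hSq⟩ := exists_finrank_eq_negIndex (quadForm (dtn src tgt ℓ 0))
  rw [← hS, Submodule.finrank_eq_zero, Submodule.eq_bot_iff]
  intro x hx
  by_contra h0
  exact absurd (hSq x hx h0) (not_lt.2 (quadForm_dtn_zero_nonneg hℓ x))

/-- Harmonic functions are the functions that are constant on the connected components. -/
theorem mem_ker_dtn_zero_iff [Fintype W] (hℓ : ∀ e, 0 < ℓ e) (φ : W → ℂ) :
    φ ∈ LinearMap.ker (dtn src tgt ℓ 0) ↔ ∀ e, φ (src e) = φ (tgt e) := by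
  rw [LinearMap.mem_ker]
  constructor
  · intro h e
    have h1 : quadForm (dtn src tgt ℓ 0) φ = 0 := by simp [quadForm, h]
    rw [quadForm_dtn, Finset.sum_eq_zero_iff_of_nonneg fun e _ => by
      rw [edgeForm_zero]; have := hℓ e; positivity] at h1
    have h2 := h1 e (Finset.mem_univ e)
    rw [edgeForm_zero, div_eq_zero_iff, or_iff_left (hℓ e).ne'] at h2
    have h3 : φ (tgt e) - φ (src e) = 0 := by simpa using h2
    exact (sub_eq_zero.1 h3).symm
  · intro h
    rw [dtn_apply]
    ext v
    simp [normalSum, startSlope, endSlope, h]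

theorem finrank_ker_dtn_zero [Fintype W] (hℓ : ∀ e, 0 < ℓ e) :
    finrank ℂ (LinearMap.ker (dtn src tgt ℓ 0)) =
      Nat.card (Quot fun v w : W => ∃ e, src e = v ∧ tgt e = w) := by
  have : Finite (Quot fun v w : W => ∃ e, src e = v ∧ tgt e = w) :=
    Finite.of_surjective _ Quot.mk_surjective
  have := Fintype.ofFinite (Quot fun v w : W => ∃ e, src e = v ∧ tgt e = w)
  let Ψ : ((Quot fun v w : W => ∃ e, src e = v ∧ tgt e = w) → ℂ) →ₗ[ℂ] (W → ℂ) :=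
    LinearMap.funLeft ℂ ℂ (Quot.mk _)
  have hΨ : Function.Injective Ψ := LinearMap.funLeft_injective_of_surjective _ _ _
    Quot.mk_surjective
  have hr : LinearMap.ker (dtn src tgt ℓ 0) = LinearMap.range Ψ := by
    ext φ
    rw [mem_ker_dtn_zero_iff hℓ]
    constructor
    · intro h
      exact ⟨Quot.lift φ (by rintro v w ⟨e, rfl, rfl⟩; exact h e), rfl⟩
    · rintro ⟨ψ, rfl⟩ e
      exact congrArg ψ (Quot.sound ⟨e, rfl, rfl⟩)
  rw [hr, LinearMap.finrank_range_of_inj hΨ, finrank_fintype_fun_eq_card, Nat.card_eq_fintype_card]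

/-- Just above zero, the negative index of the Dirichlet-to-Neumann map is the number of connected
components. -/
theorem eventually_negIndex_dtn [Fintype W] (hℓ : ∀ e, 0 < ℓ e)
    (hends : ∀ v, ∃ e, src e = v ∨ tgt e = v) {b : ℝ} (hb : 0 < b)
    (h : ∀ e, √b * ℓ e < Real.pi / 2) :
    ∃ δ > 0, ∀ ε, 0 < ε → ε < δ → negIndex (quadForm (dtn src tgt ℓ ε)) =
      Nat.card (Quot fun v w : W => ∃ e, src e = v ∧ tgt e = w) := by
  have hc : ∀ y, ContinuousAt (fun p : ℝ × (W → ℂ) => quadForm (dtn src tgt ℓ p.1) p.2) (0, y) :=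
    fun y => continuousAt_quadForm_dtn hℓ (fun e => by simp [Real.pi_pos]) y
  obtain ⟨δ, hδ, hδ'⟩ := Metric.eventually_nhds_iff.1
    (eventually_negIndex_add_ker_le (isHermitianMap_dtn src tgt ℓ) hc)
  refine ⟨min δ b, lt_min hδ hb, fun ε hε hεδ => ?_⟩
  -- Upper semicontinuity at zero bounds the index by the nullity at zero; strict decrease from zero
  -- to `ε` gives the reverse bound.
  have h1 := hδ' (y := ε) (by
    rw [Real.dist_eq, sub_zero, abs_of_pos hε]; exact hεδ.trans_le (min_le_left _ _))
  have h2 := negIndex_add_ker_le (isHermitianMap_dtn src tgt ℓ 0) fun x hx =>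
    quadForm_dtn_strictAnti hℓ hends hε (fun e => (mul_le_mul_of_nonneg_right (Real.sqrt_le_sqrt
      (hεδ.le.trans (min_le_right _ _))) (hℓ e).le).trans_lt (h e)) hx
  rw [negIndex_dtn_zero hℓ, finrank_ker_dtn_zero hℓ] at h1 h2
  omega

end DirichletToNeumann

/-! ### The coupling of the two copies of a cut vertex -/

section Coupling

open Classical in
/-- `Jᵀ J` for the jump `J φ v = φ (inr v) - φ (inl v)`. -/
def jumpCoupling {V : Type*} (B : Set V) : (V ⊕ B → ℂ) →ₗ[ℂ] (V ⊕ B → ℂ) where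
  toFun φ := Sum.elim
    (fun v => if h : v ∈ B then φ (Sum.inl v) - φ (Sum.inr ⟨v, h⟩) else 0)
    fun b => φ (Sum.inr b) - φ (Sum.inl b)
  map_add' φ ψ := by
    ext (v | b)
    · by_cases h : v ∈ B <;> simp [h]
      ring
    · simp
      ring
  map_smul' c φ := by
    ext (v | b)
    · by_cases h : v ∈ B <;> simp [h]
      ring
    · simp
      ring

variable {V : Type*} {B : Set V}

theorem jumpCoupling_inl {v : V} (h : v ∈ B) (φ : V ⊕ B → ℂ) :
    jumpCoupling B φ (Sum.inl v) = φ (Sum.inl v) - φ (Sum.inr ⟨v, h⟩) := by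
  simp [jumpCoupling, h]

theorem jumpCoupling_inl_of_notMem {v : V} (h : v ∉ B) (φ : V ⊕ B → ℂ) :
    jumpCoupling B φ (Sum.inl v) = 0 := by
  simp [jumpCoupling, h]

theorem jumpCoupling_inr (b : B) (φ : V ⊕ B → ℂ) :
    jumpCoupling B φ (Sum.inr b) = φ (Sum.inr b) - φ (Sum.inl b) := rfl

variable [Fintype V] [Fintype B]

theorem star_dotProduct_jumpCoupling (ξ φ : V ⊕ B → ℂ) :
    star ξ ⬝ᵥ jumpCoupling B φ = ∑ b : B, star (ξ (Sum.inr b) - ξ (Sum.inl b)) *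
      (φ (Sum.inr b) - φ (Sum.inl b)) := by
  classical
  have h1 : ∑ v : V, star (ξ (Sum.inl v)) * jumpCoupling B φ (Sum.inl v) =
      ∑ b : B, star (ξ (Sum.inl b)) * jumpCoupling B φ (Sum.inl b) := by
    rw [Finset.sum_set_coe B (f := fun v => star (ξ (Sum.inl v)) * jumpCoupling B φ (Sum.inl v))]
    symm
    refine Finset.sum_subset (Finset.subset_univ _) fun v _ hv => ?_
    rw [jumpCoupling_inl_of_notMem (by simpa using hv), mul_zero]
  rw [dotProduct, Fintype.sum_sum_type]
  simp only [Pi.star_apply]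
  rw [h1, ← Finset.sum_add_distrib]
  refine Finset.sum_congr rfl fun b _ => ?_
  rw [jumpCoupling_inl b.2, jumpCoupling_inr, star_sub]
  ring

theorem isHermitianMap_jumpCoupling : IsHermitianMap (jumpCoupling B) := fun x y => by
  have h : star (jumpCoupling B x) ⬝ᵥ y = star (star y ⬝ᵥ jumpCoupling B x) :=
    Matrix.star_dotProduct _ _
  rw [h, star_dotProduct_jumpCoupling, star_dotProduct_jumpCoupling, star_sum]
  refine Finset.sum_congr rfl fun b _ => ?_
  rw [star_mul', star_star]
  ring

theorem quadForm_jumpCoupling (φ : V ⊕ B → ℂ) :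
    quadForm (jumpCoupling B) φ = ∑ b : B, ‖φ (Sum.inr b) - φ (Sum.inl b)‖ ^ 2 := by
  rw [quadForm, star_dotProduct_jumpCoupling, Complex.re_sum]
  refine Finset.sum_congr rfl fun b _ => ?_
  rw [RCLike.star_def, Complex.conj_mul', ← Complex.ofReal_pow, Complex.ofReal_re]

end Coupling

/-! ### Unbounded operators given by their graphs -/

section Operators

open Module

variable {F : Type*} [NormedAddCommGroup F] [NormedSpace ℂ F]

/-- The eigenspace `{f | A f = z f}`. -/
def graphEigenspace (D : Submodule ℂ (F × F)) (z : ℂ) : Submodule ℂ F :=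
  D.comap (LinearMap.prod LinearMap.id (z • LinearMap.id))

theorem mem_graphEigenspace {D : Submodule ℂ (F × F)} {z : ℂ} {f : F} :
    f ∈ graphEigenspace D z ↔ (f, z • f) ∈ D := Iff.rfl

theorem dimKer_eq_finrank (A : F →ₗ.[ℂ] F) (z : ℂ) :
    dimKer A z = finrank ℂ (graphEigenspace A.graph z) := by
  have h : (LinearMap.ker (A.toFun - z • A.domain.subtype)).map A.domain.subtype =
      graphEigenspace A.graph z := by
    ext f
    rw [mem_graphEigenspace, LinearPMap.mem_graph_iff]
    constructor
    · rintro ⟨x, hx, rfl⟩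
      exact ⟨x, rfl, sub_eq_zero.1 hx⟩
    · rintro ⟨x, rfl, hx⟩
      exact ⟨x, sub_eq_zero.2 hx, rfl⟩
  rw [dimKer, ← h, Submodule.finrank_map_subtype_eq]

theorem finrank_eigenspace_of_notMem_spectrum {A : F →ₗ.[ℂ] F} {z : ℂ}
    (hz : z ∉ unboundedSpectrum A) : finrank ℂ (graphEigenspace A.graph z) = 0 := by
  obtain ⟨R, -, hR⟩ := not_not.1 hz
  have h : graphEigenspace A.graph z = ⊥ := by
    rw [Submodule.eq_bot_iff]
    intro f hf
    rw [mem_graphEigenspace, LinearPMap.mem_graph_iff] at hf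
    obtain ⟨x, rfl, hx⟩ := hf
    have hx' : A x = z • (x : F) := hx
    rw [← hR x, hx', sub_self, map_zero]
  rw [h, finrank_bot]

/-- Solutions may be chosen separately for each `g`: injectivity makes the choice unique, hence
linear, and the uniform estimate makes it bounded. -/
theorem notMem_spectrum_of_graph {A : F →ₗ.[ℂ] F} {z : ℂ}
    (hinj : ∀ f, (f, z • f) ∈ A.graph → f = 0)
    (hsurj : ∃ K : ℝ, ∀ g : F, ∃ f, (f, z • f + g) ∈ A.graph ∧ ‖f‖ ≤ K * ‖g‖) :
    z ∉ unboundedSpectrum A := by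
  obtain ⟨K, hK⟩ := hsurj
  choose r hr hrK using hK
  have huniq : ∀ {f g}, (f, z • f + g) ∈ A.graph → f = r g := fun {f g} h => by
    refine sub_eq_zero.1 (hinj _ ?_)
    have := A.graph.sub_mem h (hr g)
    rw [Prod.mk_sub_mk, add_sub_add_right_eq_sub, ← smul_sub] at this
    exact this
  let R : F →ₗ[ℂ] F :=
    { toFun := r
      map_add' := fun g g' => by
        refine (huniq ?_).symm
        have := A.graph.add_mem (hr g) (hr g')
        rwa [Prod.mk_add_mk, add_add_add_comm, ← smul_add] at this
      map_smul' := fun c g => by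
        refine (huniq ?_).symm
        have := A.graph.smul_mem c (hr g)
        rwa [Prod.smul_mk, smul_add, smul_comm c z] at this }
  refine not_not.2 ⟨R.mkContinuous K hrK, fun g => ?_, fun f => ?_⟩
  · obtain ⟨x, hx, hx'⟩ := A.mem_graph_iff.1 (hr g)
    have hx1 : (x : F) = r g := hx
    have hx2 : A x = z • r g + g := hx'
    refine ⟨(hx1 ▸ x.2 : r g ∈ A.domain), ?_⟩
    have hxe : (⟨R.mkContinuous K hrK g, (hx1 ▸ x.2 : r g ∈ A.domain)⟩ : A.domain) = x :=
      Subtype.ext hx1.symm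
    rw [hxe, hx2]
    exact add_sub_cancel_left _ _
  · refine (huniq (f := (f : F)) ?_).symm
    rw [add_sub_cancel]
    exact A.mem_graph f

end Operators

/-! ### Solutions on one edge -/

section Edge

open Filter Topology Asymptotics

theorem memLp_of_continuous {u : ℝ → ℂ} (hu : Continuous u) (ℓ : ℝ) :
    MemLp u 2 ((volume : Measure ℝ).restrict (Icc 0 ℓ)) := by
  obtain ⟨K, hK⟩ := isCompact_Icc.exists_bound_of_continuousOn (s := Icc 0 ℓ) hu.continuousOn
  exact MemLp.of_bound hu.aestronglyMeasurable K
    ((ae_restrict_iff' measurableSet_Icc).2 (Eventually.of_forall hK))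

/-- A continuous function as an element of `L²([0, ℓ])`. -/
def contL2 (ℓ : ℝ) {u : ℝ → ℂ} (hu : Continuous u) :
    Lp ℂ 2 ((volume : Measure ℝ).restrict (Icc 0 ℓ)) :=
  (memLp_of_continuous hu ℓ).toLp u

theorem coeFn_contL2 (ℓ : ℝ) {u : ℝ → ℂ} (hu : Continuous u) :
    contL2 ℓ hu =ᵐ[(volume : Measure ℝ).restrict (Icc 0 ℓ)] u :=
  MemLp.coeFn_toLp _

theorem integral_eq_of_ae_restrict {ℓ x : ℝ} (hx : x ∈ Icc 0 ℓ) {f g : ℝ → ℂ}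
    (h : f =ᵐ[(volume : Measure ℝ).restrict (Icc 0 ℓ)] g) :
    ∫ y in (0 : ℝ)..x, f y = ∫ y in (0 : ℝ)..x, g y := by
  refine intervalIntegral.integral_congr_ae_restrict ?_
  rw [uIoc_of_le hx.1]
  exact ae_restrict_of_ae_restrict_of_subset
    (Ioc_subset_Icc_self.trans (Icc_subset_Icc_right hx.2)) h

/-- A function with `u' = p - ∫ g` and `p' = -μ u` solves `-u'' = μ u + g`. -/
theorem isH2Rep_of_system {μ ℓ : ℝ} {f g : Lp ℂ 2 ((volume : Measure ℝ).restrict (Icc 0 ℓ))}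
    {u p P : ℝ → ℂ} (hf : f =ᵐ[(volume : Measure ℝ).restrict (Icc 0 ℓ)] u)
    (hP : ∀ x ∈ Icc 0 ℓ, P x = ∫ y in (0 : ℝ)..x, g y)
    (hu : ∀ x, HasDerivAt u (p x - P x) x) (hp : ∀ x, HasDerivAt p (-μ * u x) x) :
    IsH2Rep ℓ f (-((μ : ℂ) • f + g)) u (fun x => p x - P x) where
  ae_eq := hf
  deriv x _ := (hu x).hasDerivWithinAt
  deriv' x hx := by
    have h0 : (0 : ℝ) ∈ Icc 0 ℓ := ⟨le_rfl, hx.1.trans hx.2⟩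
    have huc : Continuous u := continuous_iff_continuousAt.2 fun x => (hu x).continuousAt
    have hw : (-((μ : ℂ) • f + g) : Lp ℂ 2 ((volume : Measure ℝ).restrict (Icc 0 ℓ)))
        =ᵐ[(volume : Measure ℝ).restrict (Icc 0 ℓ)] fun y => -μ * u y - g y := by
      filter_upwards [Lp.coeFn_neg ((μ : ℂ) • f + g), Lp.coeFn_add ((μ : ℂ) • f) g,
        Lp.coeFn_smul (μ : ℂ) f, hf] with y h1 h2 h3 h4
      rw [h1, Pi.neg_apply, h2, Pi.add_apply, h3, Pi.smul_apply, h4, smul_eq_mul]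
      ring
    have hi : ∫ y in (0 : ℝ)..x, -μ * u y = p x - p 0 :=
      intervalIntegral.integral_eq_sub_of_hasDerivAt (fun y _ => hp y)
        ((continuous_const.mul huc).intervalIntegrable _ _)
    have hμu : IntervalIntegrable (fun y => -μ * u y) volume 0 x :=
      (continuous_const.mul huc).intervalIntegrable _ _
    rw [integral_eq_of_ae_restrict hx hw, intervalIntegral.integral_sub hμu
      (IsH2Rep.intervalIntegrable hx g), hi, ← hP x hx, hP 0 h0]
    simp
    ring

/-- Eigenfunctions on an edge solve the classical equation. -/
theorem IsH2Rep.eq_modes {μ ℓ : ℝ} {f : Lp ℂ 2 ((volume : Measure ℝ).restrict (Icc 0 ℓ))}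
    {u u' : ℝ → ℂ} (h : IsH2Rep ℓ f (-((μ : ℂ) • f)) u u') {x : ℝ} (hx : x ∈ Icc 0 ℓ) :
    u x = u 0 * modeC μ x + u' 0 * modeS μ x ∧ u' x = u' 0 * modeC μ x - μ * u 0 * modeS μ x := by
  have hℓ : 0 ≤ ℓ := hx.1.trans hx.2
  have huc : ContinuousOn u (Icc 0 ℓ) := fun x hx => (h.deriv x hx).continuousWithinAt
  -- A continuous extension beyond the interval makes the fundamental theorem of calculus available
  -- at the end points.
  let v : ℝ → ℂ := IccExtend hℓ ((Icc 0 ℓ).domRestrict u)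
  have hv : Continuous v := huc.domRestrict.Icc_extend'
  have hvu : ∀ y ∈ Icc 0 ℓ, v y = u y := fun y hy => IccExtend_of_mem hℓ _ hy
  have hw : (-((μ : ℂ) • f) : Lp ℂ 2 ((volume : Measure ℝ).restrict (Icc 0 ℓ)))
      =ᵐ[(volume : Measure ℝ).restrict (Icc 0 ℓ)] fun y => -μ * v y := by
    filter_upwards [Lp.coeFn_neg ((μ : ℂ) • f), Lp.coeFn_smul (μ : ℂ) f, h.ae_eq,
      ae_restrict_mem measurableSet_Icc] with y h1 h2 h3 h4
    rw [h1, Pi.neg_apply, h2, Pi.smul_apply, h3, hvu y h4, smul_eq_mul, neg_mul]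
  refine ode_unique h.deriv (fun y hy => ?_) hx
  have h1 : HasDerivAt (fun z => u' 0 + ∫ t in (0 : ℝ)..z, -μ * v t) (-μ * v y) y :=
    ((continuous_const.mul hv).integral_hasStrictDerivAt 0 y).hasDerivAt.const_add _
  rw [← hvu y hy]
  refine h1.hasDerivWithinAt.congr (fun z hz => ?_) ?_
  · rw [h.deriv' z hz, integral_eq_of_ae_restrict hz hw]
  · rw [h.deriv' y hy, integral_eq_of_ae_restrict hy hw]

/-- The embedding of `L²` into `L¹` on a set of finite measure. -/
theorem exists_norm_integral_le (ℓ : ℝ) : ∃ K : ℝ, ∀ g : Lp ℂ 2 ((volume : Measure ℝ).restrict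
    (Icc 0 ℓ)), ∫ y in Icc 0 ℓ, ‖g y‖ ≤ K * ‖g‖ := by
  refine ⟨((volume : Measure ℝ).restrict (Icc 0 ℓ) univ ^ (1 / (1 : ℝ≥0∞).toReal -
    1 / (2 : ℝ≥0∞).toReal)).toReal, fun g => ?_⟩
  have h1 := eLpNorm_le_eLpNorm_mul_rpow_measure_univ (p := 1) (q := 2)
    (by norm_num : (1 : ℝ≥0∞) ≤ 2) (Lp.aestronglyMeasurable g)
  have h2 : ∫ y in Icc 0 ℓ, ‖g y‖ =
      (eLpNorm g 1 ((volume : Measure ℝ).restrict (Icc 0 ℓ))).toReal := by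
    rw [eLpNorm_one_eq_lintegral_enorm, integral_norm_eq_lintegral_enorm
      (Lp.aestronglyMeasurable g)]
  rw [h2, Lp.norm_def, mul_comm, ← ENNReal.toReal_mul]
  refine ENNReal.toReal_mono (ENNReal.mul_ne_top (Lp.eLpNorm_ne_top g) ?_) h1
  exact ENNReal.rpow_ne_top_of_nonneg (by norm_num) (measure_ne_top _ _)

/-- A particular solution of `-u'' = μ u + g` on an edge, with bounds. -/
theorem exists_particular_solution (μ : ℝ) {ℓ : ℝ} (hℓ : 0 ≤ ℓ) : ∃ K : ℝ,
    ∀ g : Lp ℂ 2 ((volume : Measure ℝ).restrict (Icc 0 ℓ)), ∃ u p P : ℝ → ℂ,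
      (∀ x ∈ Icc 0 ℓ, P x = ∫ y in (0 : ℝ)..x, g y) ∧
      (∀ x, HasDerivAt u (p x - P x) x) ∧ (∀ x, HasDerivAt p (-μ * u x) x) ∧
      u 0 = 0 ∧ p 0 = 0 ∧ P 0 = 0 ∧ ∀ x ∈ Icc 0 ℓ, ‖u x‖ ≤ K * ‖g‖ ∧ ‖p x - P x‖ ≤ K * ‖g‖ := by
  obtain ⟨K₁, hK₁⟩ := exists_norm_integral_le ℓ
  obtain ⟨M₁, hM₁⟩ := isCompact_Icc.exists_bound_of_continuousOn (s := Icc 0 ℓ)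
    (continuous_modeC_right μ).continuousOn
  obtain ⟨M₂, hM₂⟩ := isCompact_Icc.exists_bound_of_continuousOn (s := Icc 0 ℓ)
    (continuous_modeS_right μ).continuousOn
  set M := max M₁ M₂
  have hC : ∀ x ∈ Icc 0 ℓ, ‖(modeC μ x : ℂ)‖ ≤ M := fun x hx => by
    rw [Complex.norm_real]; exact (hM₁ x hx).trans (le_max_left _ _)
  have hS : ∀ x ∈ Icc 0 ℓ, ‖(modeS μ x : ℂ)‖ ≤ M := fun x hx => by
    rw [Complex.norm_real]; exact (hM₂ x hx).trans (le_max_right _ _)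
  have hM : 0 ≤ M := (norm_nonneg _).trans (hC 0 ⟨le_rfl, hℓ⟩)
  -- Each product of a mode with `α` or `β` is at most `M * (M * ℓ)` times the bound for `P`. The
  -- factor `1 + 2 * |μ|` covers these products in `u` and in `p`, and the last `1` covers `P`
  -- itself.
  refine ⟨(M * (M * ℓ) * (1 + 2 * |μ|) + 1) * K₁, fun g => ?_⟩
  have hgi : Integrable ((Icc 0 ℓ).indicator g) volume :=
    (integrable_indicator_iff measurableSet_Icc).2 ((Lp.memLp g).integrable (by norm_num))
  let P : ℝ → ℂ := fun x => ∫ y in (0 : ℝ)..x, (Icc 0 ℓ).indicator g y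
  have hPc : Continuous P := hgi.continuous_primitive 0
  have hPn : ∀ x, ‖P x‖ ≤ K₁ * ‖g‖ := fun x => by
    refine le_trans ?_ (hK₁ g)
    refine intervalIntegral.norm_integral_le_integral_norm_uIoc.trans
      ((setIntegral_le_integral hgi.norm (Filter.Eventually.of_forall fun y => norm_nonneg _)).trans
        (le_of_eq ?_))
    simp_rw [norm_indicator_eq_indicator_norm]
    exact integral_indicator measurableSet_Icc
  have hΓ : 0 ≤ K₁ * ‖g‖ := (norm_nonneg _).trans (hPn 0)
  have hCc : Continuous fun x => (modeC μ x : ℂ) :=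
    Complex.continuous_ofReal.comp (continuous_modeC_right μ)
  have hSc : Continuous fun x => (modeS μ x : ℂ) :=
    Complex.continuous_ofReal.comp (continuous_modeS_right μ)
  have hCd : ∀ x, HasDerivAt (fun x => (modeC μ x : ℂ)) (-μ * modeS μ x) x := fun x => by
    have := (hasDerivAt_modeC μ x).ofReal_comp
    push_cast at this
    exact this
  have hSd : ∀ x, HasDerivAt (fun x => (modeS μ x : ℂ)) (modeC μ x) x := fun x =>
    (hasDerivAt_modeS μ x).ofReal_comp
  -- Variation of constants for the system `u' = p - P`, `p' = -μ u`. Only the continuous primitive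
  -- `P` enters, so `u` and `p` are classically differentiable although `g` is merely square
  -- integrable.
  let α : ℝ → ℂ := fun x => ∫ y in (0 : ℝ)..x, modeC μ y * P y
  let β : ℝ → ℂ := fun x => ∫ y in (0 : ℝ)..x, modeS μ y * P y
  have hα : ∀ x, HasDerivAt α (modeC μ x * P x) x := fun x =>
    ((hCc.mul hPc).integral_hasStrictDerivAt 0 x).hasDerivAt
  have hβ : ∀ x, HasDerivAt β (modeS μ x * P x) x := fun x =>
    ((hSc.mul hPc).integral_hasStrictDerivAt 0 x).hasDerivAt
  have hintegral : ∀ {F : ℝ → ℂ}, (∀ x ∈ Icc 0 ℓ, ‖F x‖ ≤ M) → ∀ x ∈ Icc 0 ℓ,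
      ‖∫ y in (0 : ℝ)..x, F y * P y‖ ≤ M * ℓ * (K₁ * ‖g‖) := fun {F} hF x hx => by
    have := intervalIntegral.norm_integral_le_of_norm_le_const (a := 0) (b := x)
      (f := fun y => F y * P y) (C := M * (K₁ * ‖g‖)) fun y hy => by
        rw [uIoc_of_le hx.1] at hy
        rw [norm_mul]
        exact mul_le_mul (hF y ⟨hy.1.le, hy.2.trans hx.2⟩) (hPn y) (norm_nonneg _) hM
    refine this.trans ?_
    rw [sub_zero, abs_of_nonneg hx.1]
    calc M * (K₁ * ‖g‖) * x ≤ M * (K₁ * ‖g‖) * ℓ :=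
          mul_le_mul_of_nonneg_left hx.2 (mul_nonneg hM hΓ)
      _ = M * ℓ * (K₁ * ‖g‖) := by ring
  have h1 : ∀ x, (modeC μ x : ℂ) ^ 2 + μ * (modeS μ x : ℂ) ^ 2 = 1 := fun x => by
    exact_mod_cast congrArg Complex.ofReal (modeC_sq_add μ x)
  have hprod : ∀ {y z : ℂ}, ‖y‖ ≤ M → ‖z‖ ≤ M * ℓ * (K₁ * ‖g‖) →
      ‖y * z‖ ≤ M * (M * ℓ) * (K₁ * ‖g‖) := fun {y z} hy hz => by
    rw [norm_mul, mul_assoc M]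
    exact mul_le_mul hy hz (norm_nonneg _) hM
  have hL : 0 ≤ M * (M * ℓ) * (K₁ * ‖g‖) := by positivity
  refine ⟨fun x => -(modeC μ x * α x + μ * (modeS μ x * β x)),
    fun x => μ * (modeS μ x * α x - modeC μ x * β x), P, fun x hx => ?_, fun x => ?_, fun x => ?_,
    by simp [α], by simp [β], by simp [P], fun x hx => ?_⟩
  · refine integral_eq_of_ae_restrict hx ?_
    filter_upwards [ae_restrict_mem measurableSet_Icc] with y hy
    exact indicator_of_mem hy _
  · refine ((((hCd x).mul (hα x)).add (((hSd x).mul (hβ x)).const_mul (μ : ℂ))).neg).congr_deriv ?_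
    linear_combination (-P x) * h1 x
  · refine ((((hSd x).mul (hα x)).sub ((hCd x).mul (hβ x))).const_mul (μ : ℂ)).congr_deriv ?_
    ring
  · have b1 := hprod (hC x hx) (hintegral hC x hx)
    have b2 := hprod (hS x hx) (hintegral hS x hx)
    have b3 := hprod (hS x hx) (hintegral hC x hx)
    have b4 := hprod (hC x hx) (hintegral hS x hx)
    have hμ : ∀ z : ℂ, ‖(μ : ℂ) * z‖ = |μ| * ‖z‖ := fun z => by
      rw [norm_mul, Complex.norm_real, Real.norm_eq_abs]
    have hKe : (M * (M * ℓ) * (1 + 2 * |μ|) + 1) * K₁ * ‖g‖ =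
        M * (M * ℓ) * (K₁ * ‖g‖) + 2 * (|μ| * (M * (M * ℓ) * (K₁ * ‖g‖))) + K₁ * ‖g‖ := by ring
    have hL' : 0 ≤ |μ| * (M * (M * ℓ) * (K₁ * ‖g‖)) := mul_nonneg (abs_nonneg μ) hL
    rw [hKe]
    constructor
    · rw [norm_neg]
      refine (norm_add_le _ _).trans ?_
      rw [hμ]
      have := mul_le_mul_of_nonneg_left b2 (abs_nonneg μ)
      linarith
    · refine (norm_sub_le _ _).trans ?_
      rw [hμ]
      have b5 := mul_le_mul_of_nonneg_left ((norm_sub_le _ _).trans (add_le_add b3 b4))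
        (abs_nonneg μ)
      linarith [hPn x]

end Edge

/-! ### Laplacians with general vertex couplings -/

section Network

open Module Filter Topology Asymptotics

variable {W E : Type*} [Fintype E]

/-- `⨁ₑ L²([0, ℓ e])`. -/
abbrev EdgeL2 (ℓ : E → ℝ) : Type _ :=
  PiLp 2 fun e : E => Lp ℂ 2 ((volume : Measure ℝ).restrict (Icc 0 (ℓ e)))

/-- `p.2 = -p.1''`, the function `p.1` is continuous at the vertices, and the sums of its outward
derivatives at the vertices are obtained from its vertex values by `X`. -/
def IsCoupledSolution (src tgt : E → W) (ℓ : E → ℝ) (X : (W → ℂ) →ₗ[ℂ] (W → ℂ))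
    (p : EdgeL2 ℓ × EdgeL2 ℓ) : Prop :=
  ∃ u u' : E → ℝ → ℂ, (∀ e, IsH2Rep (ℓ e) (p.1 e) (-(p.2 e)) (u e) (u' e)) ∧
    ∃ φ : W → ℂ, (∀ e, u e 0 = φ (src e)) ∧ (∀ e, u e (ℓ e) = φ (tgt e)) ∧
      normalSum src tgt (fun e => u' e 0) (fun e => u' e (ℓ e)) = X φ

variable {src tgt : E → W} {ℓ : E → ℝ} {X : (W → ℂ) →ₗ[ℂ] (W → ℂ)}

theorem startSlope_mul_modeC {μ ℓ : ℝ} (hS : modeS μ ℓ ≠ 0) (a b : ℂ) :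
    startSlope μ ℓ a b * modeC μ ℓ - μ * a * modeS μ ℓ = endSlope μ ℓ a b := by
  have h1 : (modeC μ ℓ : ℂ) ^ 2 + μ * (modeS μ ℓ : ℂ) ^ 2 = 1 := by
    exact_mod_cast congrArg Complex.ofReal (modeC_sq_add μ ℓ)
  have hS' : (modeS μ ℓ : ℂ) ≠ 0 := by exact_mod_cast hS
  rw [startSlope, endSlope]
  field_simp
  linear_combination (-a) * h1

theorem startSlope_mul_modeS {μ ℓ : ℝ} (hS : modeS μ ℓ ≠ 0) (a b : ℂ) :
    a * modeC μ ℓ + startSlope μ ℓ a b * modeS μ ℓ = b := by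
  have hS' : (modeS μ ℓ : ℂ) ≠ 0 := by exact_mod_cast hS
  rw [startSlope]
  field_simp
  ring

theorem continuous_modes (μ : ℝ) (a b : ℂ) :
    Continuous fun x => a * modeC μ x + b * modeS μ x := by
  have h1 := continuous_modeC_right μ
  have h2 := continuous_modeS_right μ
  fun_prop

theorem hasDerivAt_modes (μ : ℝ) (a b : ℂ) (x : ℝ) :
    HasDerivAt (fun x => a * modeC μ x + b * modeS μ x) (b * modeC μ x - μ * a * modeS μ x) x ∧
    HasDerivAt (fun x => b * modeC μ x - μ * a * modeS μ x)
      (-μ * (a * modeC μ x + b * modeS μ x)) x := by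
  have hC := (hasDerivAt_modeC μ x).ofReal_comp
  have hS := (hasDerivAt_modeS μ x).ofReal_comp
  push_cast at hC
  refine ⟨((hC.const_mul a).add (hS.const_mul b)).congr_deriv (by ring),
    ((hC.const_mul b).sub (hS.const_mul (μ * a))).congr_deriv (by ring)⟩

theorem isH2Rep_modes {μ ℓ : ℝ} {a b : ℂ} {f : Lp ℂ 2 ((volume : Measure ℝ).restrict (Icc 0 ℓ))}
    (hf : f =ᵐ[(volume : Measure ℝ).restrict (Icc 0 ℓ)] fun x => a * modeC μ x + b * modeS μ x) :
    IsH2Rep ℓ f (-((μ : ℂ) • f)) (fun x => a * modeC μ x + b * modeS μ x)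
      (fun x => b * modeC μ x - μ * a * modeS μ x) := by
  have := isH2Rep_of_system (μ := μ) (g := 0) (P := 0) hf
    (fun x hx => by
      rw [integral_eq_of_ae_restrict hx (Lp.coeFn_zero ..)]
      simp)
    (fun x => by simpa using (hasDerivAt_modes μ a b x).1)
    (fun x => (hasDerivAt_modes μ a b x).2)
  simpa using this

variable (src tgt ℓ) in
/-- The solution of `u'' = -μ u` on the edges with given vertex values. -/
def harmonicExtension (μ : ℝ) : (W → ℂ) →ₗ[ℂ] EdgeL2 ℓ where
  toFun φ := WithLp.toLp 2 fun e =>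
    φ (src e) • contL2 (ℓ e) (Complex.continuous_ofReal.comp (continuous_modeC_right μ)) +
    startSlope μ (ℓ e) (φ (src e)) (φ (tgt e)) •
      contL2 (ℓ e) (Complex.continuous_ofReal.comp (continuous_modeS_right μ))
  map_add' φ ψ := by
    ext1 e
    have : startSlope μ (ℓ e) (φ (src e) + ψ (src e)) (φ (tgt e) + ψ (tgt e)) =
        startSlope μ (ℓ e) (φ (src e)) (φ (tgt e)) +
          startSlope μ (ℓ e) (ψ (src e)) (ψ (tgt e)) := by
      simp only [startSlope]; ring
    simp only [Pi.add_apply, PiLp.add_apply, this, add_smul]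
    abel
  map_smul' c φ := by
    ext1 e
    have : startSlope μ (ℓ e) (c * φ (src e)) (c * φ (tgt e)) =
        c * startSlope μ (ℓ e) (φ (src e)) (φ (tgt e)) := by
      simp only [startSlope]; ring
    simp only [Pi.smul_apply, PiLp.smul_apply, smul_eq_mul, this, RingHom.id_apply, smul_add,
      smul_smul]

theorem coeFn_harmonicExtension {E : Type*} {src tgt : E → W} {ℓ : E → ℝ} (μ : ℝ)
    (φ : W → ℂ) (e : E) :
    harmonicExtension src tgt ℓ μ φ e =ᵐ[(volume : Measure ℝ).restrict (Icc 0 (ℓ e))]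
      fun x => φ (src e) * modeC μ x + startSlope μ (ℓ e) (φ (src e)) (φ (tgt e)) * modeS μ x := by
  have hC : Continuous fun x => (modeC μ x : ℂ) :=
    Complex.continuous_ofReal.comp (continuous_modeC_right μ)
  have hS : Continuous fun x => (modeS μ x : ℂ) :=
    Complex.continuous_ofReal.comp (continuous_modeS_right μ)
  filter_upwards [Lp.coeFn_add (φ (src e) • contL2 (ℓ e) hC)
    (startSlope μ (ℓ e) (φ (src e)) (φ (tgt e)) • contL2 (ℓ e) hS),
    Lp.coeFn_smul (φ (src e)) (contL2 (ℓ e) hC),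
    Lp.coeFn_smul (startSlope μ (ℓ e) (φ (src e)) (φ (tgt e))) (contL2 (ℓ e) hS),
    coeFn_contL2 (ℓ e) hC, coeFn_contL2 (ℓ e) hS] with x h1 h2 h3 h4 h5
  refine h1.trans ?_
  rw [Pi.add_apply, h2, h3, Pi.smul_apply, Pi.smul_apply, h4, h5, smul_eq_mul, smul_eq_mul]

theorem harmonicExtension_injective {E : Type*} {src tgt : E → W} {ℓ : E → ℝ} (hℓ : ∀ e, 0 < ℓ e)
    (hends : ∀ v, ∃ e, src e = v ∨ tgt e = v) {μ : ℝ} (hμ : ∀ e, √μ * ℓ e < Real.pi / 2) :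
    Function.Injective (harmonicExtension src tgt ℓ μ) := by
  rw [injective_iff_map_eq_zero]
  intro φ hφ
  have key : ∀ e, φ (src e) = 0 ∧ φ (tgt e) = 0 := fun e => by
    have h1 := coeFn_harmonicExtension (src := src) (tgt := tgt) (ℓ := ℓ) μ φ e
    rw [hφ] at h1
    have h2 := Measure.eqOn_Icc_of_ae_eq volume (hℓ e).ne ((Lp.coeFn_zero ..).symm.trans h1)
      continuousOn_const (continuous_modes μ _ _).continuousOn
    have h3 := h2 (left_mem_Icc.2 (hℓ e).le)
    have h4 := h2 (right_mem_Icc.2 (hℓ e).le)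
    simp only [startSlope_mul_modeS (modeS_pos (hℓ e) (hμ e)).ne'] at h4
    simp only [modeC_zero_right, modeS_zero_right, Complex.ofReal_one, Complex.ofReal_zero,
      mul_one, mul_zero, add_zero] at h3
    exact ⟨h3.symm, h4.symm⟩
  ext v
  obtain ⟨e, rfl | rfl⟩ := hends v
  · exact (key e).1
  · exact (key e).2

/-- The reduction of the eigenvalue problem to the vertices: as `modeS μ (ℓ e) ≠ 0`, end values
determine the solution on each edge, and the only condition left is that the outward derivatives
match `X φ`. -/
theorem map_harmonicExtension (hℓ : ∀ e, 0 < ℓ e) {μ : ℝ} (hμ : ∀ e, √μ * ℓ e < Real.pi / 2)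
    {D : Submodule ℂ (EdgeL2 ℓ × EdgeL2 ℓ)} (hD : ∀ p, p ∈ D ↔ IsCoupledSolution src tgt ℓ X p) :
    (LinearMap.ker (dtn src tgt ℓ μ - X)).map (harmonicExtension src tgt ℓ μ) =
      graphEigenspace D μ := by
  have hS : ∀ e, modeS μ (ℓ e) ≠ 0 := fun e => (modeS_pos (hℓ e) (hμ e)).ne'
  ext f
  rw [mem_graphEigenspace, hD]
  constructor
  · rintro ⟨φ, hφ, rfl⟩
    refine ⟨_, _, fun e => isH2Rep_modes (coeFn_harmonicExtension μ φ e), φ, fun e => ?_,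
      fun e => ?_, ?_⟩
    · simp
    · exact startSlope_mul_modeS (hS e) _ _
    · rw [← sub_eq_zero.1 hφ, dtn_apply]
      congr 1
      · ext e
        simp
      · ext e
        exact startSlope_mul_modeC (hS e) _ _
  · rintro ⟨u, u', hrep, φ, h0, h1, hX⟩
    have hrep' : ∀ e, IsH2Rep (ℓ e) (f e) (-((μ : ℂ) • f e)) (u e) (u' e) := hrep
    have hS' : ∀ e, (modeS μ (ℓ e) : ℂ) ≠ 0 := fun e => by exact_mod_cast hS e
    have hslope : ∀ e, u' e 0 = startSlope μ (ℓ e) (φ (src e)) (φ (tgt e)) := fun e => by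
      have h2 := ((hrep' e).eq_modes (right_mem_Icc.2 (hℓ e).le)).1
      rw [h0, h1] at h2
      rw [startSlope, eq_div_iff (hS' e), h2]
      ring
    have hend : ∀ e, u' e (ℓ e) = endSlope μ (ℓ e) (φ (src e)) (φ (tgt e)) := fun e => by
      rw [((hrep' e).eq_modes (right_mem_Icc.2 (hℓ e).le)).2, hslope, h0,
        startSlope_mul_modeC (hS e)]
    refine ⟨φ, ?_, ?_⟩
    · simp only [hslope, hend] at hX
      exact sub_eq_zero.2 hX
    · ext1 e
      apply Lp.ext
      refine (coeFn_harmonicExtension μ φ e).trans ?_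
      filter_upwards [(hrep' e).ae_eq, ae_restrict_mem measurableSet_Icc] with x hx hx'
      rw [hx, ((hrep' e).eq_modes hx').1, h0, hslope]

theorem finrank_graphEigenspace [Finite W] (hℓ : ∀ e, 0 < ℓ e)
    (hends : ∀ v, ∃ e, src e = v ∨ tgt e = v) {μ : ℝ} (hμ : ∀ e, √μ * ℓ e < Real.pi / 2)
    {D : Submodule ℂ (EdgeL2 ℓ × EdgeL2 ℓ)} (hD : ∀ p, p ∈ D ↔ IsCoupledSolution src tgt ℓ X p) :
    finrank ℂ (graphEigenspace D μ) = finrank ℂ (LinearMap.ker (dtn src tgt ℓ μ - X)) := by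
  rw [← map_harmonicExtension hℓ hμ hD]
  exact (Submodule.equivMapOfInjective _ (harmonicExtension_injective hℓ hends hμ)
    _).finrank_eq.symm

theorem normalSum_add (p q p' q' : E → ℂ) :
    normalSum src tgt (fun e => p e + p' e) (fun e => q e + q' e) =
      normalSum src tgt p q + normalSum src tgt p' q' := by
  ext v
  simp only [normalSum, Pi.add_apply, Finset.sum_add_distrib]
  ring

theorem EdgeL2.norm_le_sum (f : EdgeL2 ℓ) : ‖f‖ ≤ ∑ e, ‖f e‖ := by
  refine abs_le_of_sq_le_sq' ?_ (Finset.sum_nonneg fun e _ => norm_nonneg _) |>.2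
  rw [PiLp.norm_sq_eq_of_L2]
  exact Finset.sum_sq_le_sq_sum_of_nonneg fun e _ => norm_nonneg _

/-- Solvability of `-f'' = μ f + g` with a bound. -/
theorem exists_isCoupledSolution [Finite W] (hℓ : ∀ e, 0 < ℓ e) {μ : ℝ}
    (hμ : ∀ e, √μ * ℓ e < Real.pi / 2)
    (hker : finrank ℂ (LinearMap.ker (dtn src tgt ℓ μ - X)) = 0) :
    ∃ K : ℝ, ∀ g : EdgeL2 ℓ, ∃ f : EdgeL2 ℓ,
      IsCoupledSolution src tgt ℓ X (f, (μ : ℂ) • f + g) ∧ ‖f‖ ≤ K * ‖g‖ := by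
  have := Fintype.ofFinite W
  have hS : ∀ e, modeS μ (ℓ e) ≠ 0 := fun e => (modeS_pos (hℓ e) (hμ e)).ne'
  have hS' : ∀ e, (modeS μ (ℓ e) : ℂ) ≠ 0 := fun e => by exact_mod_cast hS e
  choose K hK using fun e => exists_particular_solution μ (hℓ e).le
  choose u p P hP hu hp hu0 hp0 hP0 hbd using hK
  let a : E → EdgeL2 ℓ → ℂ := fun e g => u e (g e) (ℓ e)
  let d : E → EdgeL2 ℓ → ℂ := fun e g => p e (g e) (ℓ e) - P e (g e) (ℓ e)
  -- A big O along the filter `⊤` is a global bound by a multiple of `‖g‖`, which spares the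
  -- bookkeeping of constants.
  have hcoord : ∀ e, (fun g : EdgeL2 ℓ => g e) =O[⊤] fun g : EdgeL2 ℓ => g := fun e =>
    isBigO_top.2 ⟨1, fun g => by simpa using PiLp.norm_apply_le g e⟩
  have hae : ∀ e, a e =O[⊤] fun g : EdgeL2 ℓ => g := fun e =>
    (isBigO_top.2 ⟨K e, fun g : EdgeL2 ℓ => (hbd e (g e) (ℓ e) (right_mem_Icc.2
      (hℓ e).le)).1⟩).trans (hcoord e)
  have hde : ∀ e, d e =O[⊤] fun g : EdgeL2 ℓ => g := fun e =>
    (isBigO_top.2 ⟨K e, fun g : EdgeL2 ℓ => (hbd e (g e) (ℓ e) (right_mem_Icc.2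
      (hℓ e).le)).2⟩).trans (hcoord e)
  -- Adding `s` times `modeS` to the particular solution makes it vanish at both ends of the edge.
  let s : E → EdgeL2 ℓ → ℂ := fun e g => -(modeS μ (ℓ e) : ℂ)⁻¹ * a e g
  have hse : ∀ e, s e =O[⊤] fun g : EdgeL2 ℓ => g := fun e => (hae e).const_mul_left _
  -- `ρ` holds the outward derivatives of this Dirichlet solution. The vertex values `φ` of the
  -- homogeneous part must compensate them, `(dtn - X) φ = -ρ`, which is solvable because the kernel
  -- is trivial.
  let ρ : EdgeL2 ℓ → W → ℂ := fun g =>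
    normalSum src tgt (fun e => s e g) fun e => modeC μ (ℓ e) * s e g + d e g
  have hρ : ρ =O[⊤] fun g : EdgeL2 ℓ => g := isBigO_pi.2 fun v =>
    (IsBigO.fun_sum fun e _ => ((hse e).const_mul_left _).add (hde e)).sub
      (IsBigO.fun_sum fun e _ => hse e)
  let T := LinearEquiv.ofInjectiveEndo (dtn src tgt ℓ μ - X)
    (LinearMap.ker_eq_bot.1 (Submodule.finrank_eq_zero.1 hker))
  let φ : EdgeL2 ℓ → W → ℂ := fun g => T.symm (-ρ g)
  have hφ : φ =O[⊤] fun g : EdgeL2 ℓ => g :=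
    ((T.symm.toContinuousLinearEquiv : (W → ℂ) →L[ℂ] (W → ℂ)).isBigO_comp
      (fun g => -ρ g) ⊤).trans hρ.neg_left
  have hφv : ∀ v, (fun g => φ g v) =O[⊤] fun g : EdgeL2 ℓ => g := isBigO_pi.1 hφ
  have hTφ : ∀ g, dtn src tgt ℓ μ (φ g) + ρ g = X (φ g) := fun g => by
    have h1 : (dtn src tgt ℓ μ - X) (φ g) = -ρ g := T.apply_symm_apply (-ρ g)
    rw [LinearMap.sub_apply] at h1
    rw [← sub_eq_zero, add_sub_right_comm, h1, neg_add_cancel]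
  let b : E → EdgeL2 ℓ → ℂ := fun e g =>
    startSlope μ (ℓ e) (φ g (src e)) (φ g (tgt e)) + s e g
  have hb : ∀ e, b e =O[⊤] fun g : EdgeL2 ℓ => g := fun e => by
    refine IsBigO.add ?_ (hse e)
    simp only [startSlope, div_eq_inv_mul]
    exact ((hφv _).sub ((hφv _).const_mul_left _)).const_mul_left _
  let U : E → EdgeL2 ℓ → ℝ → ℂ := fun e g x =>
    u e (g e) x + (φ g (src e) * modeC μ x + b e g * modeS μ x)
  let Q : E → EdgeL2 ℓ → ℝ → ℂ := fun e g x =>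
    p e (g e) x + (b e g * modeC μ x - μ * φ g (src e) * modeS μ x)
  have hU : ∀ e g x, HasDerivAt (U e g) (Q e g x - P e (g e) x) x := fun e g x =>
    ((hu e (g e) x).add (hasDerivAt_modes μ (φ g (src e)) (b e g) x).1).congr_deriv (by
      simp only [Q]; ring)
  have hQ : ∀ e g x, HasDerivAt (Q e g) (-μ * U e g x) x := fun e g x =>
    ((hp e (g e) x).add (hasDerivAt_modes μ (φ g (src e)) (b e g) x).2).congr_deriv (by
      simp only [U]; ring)
  have hUc : ∀ e g, Continuous (U e g) := fun e g =>
    continuous_iff_continuousAt.2 fun x => (hU e g x).continuousAt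
  let f : EdgeL2 ℓ → EdgeL2 ℓ := fun g => WithLp.toLp 2 fun e => contL2 (ℓ e) (hUc e g)
  have hfe : ∀ e, (fun g => f g e) =O[⊤] fun g : EdgeL2 ℓ => g := fun e => by
    obtain ⟨M₁, hM₁⟩ := isCompact_Icc.exists_bound_of_continuousOn (s := Icc 0 (ℓ e))
      (continuous_modeC_right μ).continuousOn
    obtain ⟨M₂, hM₂⟩ := isCompact_Icc.exists_bound_of_continuousOn (s := Icc 0 (ℓ e))
      (continuous_modeS_right μ).continuousOn
    have hmaj : (fun g : EdgeL2 ℓ => K e * ‖g e‖ + (M₁ * ‖φ g (src e)‖ + M₂ * ‖b e g‖)) =O[⊤]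
        fun g : EdgeL2 ℓ => g :=
      ((hcoord e).norm_left.const_mul_left _).add
        (((hφv _).norm_left.const_mul_left _).add ((hb e).norm_left.const_mul_left _))
    refine IsBigO.trans (isBigO_top.2 ⟨measureUnivNNReal ((volume : Measure ℝ).restrict
      (Icc 0 (ℓ e))) ^ (2 : ℝ≥0∞).toReal⁻¹, fun g => ?_⟩) hmaj
    have hbound : ∀ x ∈ Icc 0 (ℓ e), ‖U e g x‖ ≤
        K e * ‖g e‖ + (M₁ * ‖φ g (src e)‖ + M₂ * ‖b e g‖) := fun x hx => by
      refine (norm_add_le _ _).trans (add_le_add (hbd e (g e) x hx).1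
        ((norm_add_le _ _).trans (add_le_add ?_ ?_)))
      · rw [norm_mul, mul_comm, Complex.norm_real]
        exact mul_le_mul_of_nonneg_right (hM₁ x hx) (norm_nonneg _)
      · rw [norm_mul, mul_comm, Complex.norm_real]
        exact mul_le_mul_of_nonneg_right (hM₂ x hx) (norm_nonneg _)
    have hnn := (norm_nonneg _).trans (hbound 0 (left_mem_Icc.2 (hℓ e).le))
    rw [Real.norm_of_nonneg hnn]
    refine Lp.norm_le_of_ae_bound hnn ?_
    filter_upwards [coeFn_contL2 (ℓ e) (hUc e g), ae_restrict_mem measurableSet_Icc] with x h1 h2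
    refine le_trans (le_of_eq ?_) (hbound x h2)
    exact congrArg norm h1
  obtain ⟨Kf, hKf⟩ := isBigO_top.1 (IsBigO.fun_sum (A := fun e g => ‖f g e‖) (s := Finset.univ)
    fun e _ => (hfe e).norm_left)
  refine ⟨Kf, fun g => ⟨f g, ⟨fun e => U e g, fun e x => Q e g x - P e (g e) x,
    fun e => isH2Rep_of_system (coeFn_contL2 (ℓ e) (hUc e g)) (hP e (g e)) (hU e g) (hQ e g),
    φ g, fun e => ?_, fun e => ?_, ?_⟩, ?_⟩⟩
  · simp [U, hu0]
  · have h1 := startSlope_mul_modeS (hS e) (φ g (src e)) (φ g (tgt e))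
    have h2 : a e g + s e g * modeS μ (ℓ e) = 0 := by
      simp only [s]
      field_simp [hS' e]
      ring
    simp only [U, b]
    linear_combination h1 + h2
  · rw [← hTφ, dtn_apply, ← normalSum_add]
    congr 1
    · ext e
      simp [Q, hp0, hP0, b]
    · ext e
      rw [← startSlope_mul_modeC (hS e)]
      simp only [Q, b, d]
      ring
  · refine (EdgeL2.norm_le_sum (f g)).trans ?_
    have := hKf g
    rwa [Real.norm_of_nonneg (Finset.sum_nonneg fun e _ => norm_nonneg _)] at this

theorem notMem_spectrum_of_finrank_ker [Finite W] (hℓ : ∀ e, 0 < ℓ e) {μ : ℝ}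
    (hμ : ∀ e, √μ * ℓ e < Real.pi / 2)
    {A : EdgeL2 ℓ →ₗ.[ℂ] EdgeL2 ℓ} (hA : ∀ p, p ∈ A.graph ↔ IsCoupledSolution src tgt ℓ X p)
    (hker : finrank ℂ (LinearMap.ker (dtn src tgt ℓ μ - X)) = 0) :
    (μ : ℂ) ∉ unboundedSpectrum A := by
  refine notMem_spectrum_of_graph (fun f hf => ?_) ?_
  · rw [← mem_graphEigenspace, ← map_harmonicExtension hℓ hμ hA,
      Submodule.finrank_eq_zero.1 hker, Submodule.map_bot] at hf
    exact hf
  · obtain ⟨K, hK⟩ := exists_isCoupledSolution hℓ hμ hker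
    refine ⟨K, fun g => ?_⟩
    obtain ⟨f, hf, hfK⟩ := hK g
    exact ⟨f, (hA _).2 hf, hfK⟩

end Network

/-! ### The `δ'` family as a family of coupled Laplacians -/

namespace MetricGraph

variable {V E : Type*} (G : MetricGraph V E)

theorem exists_unique_ends [Finite E] {v : V} (hdeg : G.degree v = 2)
    (horient : (∃ e, G.tgt e = v) ∧ ∃ e, G.src e = v) :
    ∃ e₁ e₂, (∀ e, G.tgt e = v ↔ e = e₁) ∧ ∀ e, G.src e = v ↔ e = e₂ := by
  obtain ⟨⟨e₁, h₁⟩, e₂, h₂⟩ := horient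
  have : Nonempty {e // G.tgt e = v} := ⟨⟨e₁, h₁⟩⟩
  have : Nonempty {e // G.src e = v} := ⟨⟨e₂, h₂⟩⟩
  have p₁ : 0 < Nat.card {e // G.tgt e = v} := Nat.card_pos
  have p₂ : 0 < Nat.card {e // G.src e = v} := Nat.card_pos
  rw [degree] at hdeg
  have s₁ := (Nat.card_eq_one_iff_unique.1 (show Nat.card {e // G.tgt e = v} = 1 by omega)).1
  have s₂ := (Nat.card_eq_one_iff_unique.1 (show Nat.card {e // G.src e = v} = 1 by omega)).1
  refine ⟨e₁, e₂, fun e => ⟨fun h => ?_, fun h => h ▸ h₁⟩, fun e => ⟨fun h => ?_, fun h => h ▸ h₂⟩⟩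
  · exact congrArg Subtype.val (s₁.elim ⟨e, h⟩ ⟨e₁, h₁⟩)
  · exact congrArg Subtype.val (s₂.elim ⟨e, h⟩ ⟨e₂, h₂⟩)

/-- At `α = π / 2` the two traces are `-f'` and `f`. With parameter zero a cut vertex becomes an
ordinary Kirchhoff vertex of degree two. -/
theorem deltaCond_zero (f₁ f₁' f₂ f₂' : ℂ) :
    DeltaCond (Real.pi / 2) 0 f₁ f₁' f₂ f₂' ↔ f₁' = f₂' ∧ f₁ = f₂ := by
  simp only [DeltaCond, robinTrace, robinTraceStar, Real.cos_pi_div_two, Real.sin_pi_div_two]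
  constructor
  · intro h
    obtain ⟨h1, h2⟩ := h.2 0 rfl
    push_cast at h1 h2
    exact ⟨by linear_combination -h1, by linear_combination -h2⟩
  · rintro ⟨rfl, rfl⟩
    refine ⟨fun h => by simp at h, fun r hr => ⟨rfl, ?_⟩⟩
    have : r = 0 := by exact_mod_cast hr.symm
    simp [this]

/-- In terms of the coupling strength `t⁻¹` the case `t = ⊤` needs no separate formula: `toReal ⊤ =
0` and `0⁻¹ = 0` give coupling zero, which is the decoupled condition. -/
theorem deltaCond_of_pos {t : EReal} (ht : 0 < t) (f₁ f₁' f₂ f₂' : ℂ) :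
    DeltaCond (Real.pi / 2) t f₁ f₁' f₂ f₂' ↔
      f₁' = ((t.toReal⁻¹ : ℝ) : ℂ) * (f₁ - f₂) ∧ f₂' = ((t.toReal⁻¹ : ℝ) : ℂ) * (f₁ - f₂) := by
  simp only [DeltaCond, robinTrace, robinTraceStar, Real.cos_pi_div_two, Real.sin_pi_div_two]
  induction t with
  | bot => simp at ht
  | top => simp
  | coe r =>
    have hr : (r : ℂ) ≠ 0 := by
      have : 0 < r := by exact_mod_cast ht
      exact_mod_cast this.ne'
    simp only [EReal.coe_ne_top, EReal.coe_ne_bot, or_self, false_imp_iff, true_and,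
      EReal.coe_eq_coe_iff, forall_eq', EReal.toReal_coe]
    push_cast
    constructor
    · rintro ⟨h1, h2⟩
      refine ⟨?_, ?_⟩
      · field_simp
        linear_combination h2
      · field_simp
        linear_combination h2 + r * h1
    · rintro ⟨h1, h2⟩
      refine ⟨by linear_combination h2 - h1, ?_⟩
      rw [h1]
      field_simp
      ring

theorem cut_tgt_eq_inl {B : Set V} {e : E} {v : V} :
    (G.cut B).tgt e = Sum.inl v ↔ G.tgt e = v ∧ v ∉ B := by
  simp only [cut]
  split_ifs with h
  · simp only [false_iff, not_and, not_not]
    rintro rfl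
    exact h
  · simp only [Sum.inl.injEq]
    constructor
    · rintro rfl
      exact ⟨rfl, h⟩
    · exact fun h => h.1

theorem cut_tgt_eq_inr {B : Set V} {e : E} {b : B} :
    (G.cut B).tgt e = Sum.inr b ↔ G.tgt e = b := by
  simp only [cut]
  split_ifs with h
  · simp [Subtype.ext_iff]
  · simp only [false_iff]
    rintro h'
    exact h (h' ▸ b.2)

theorem cut_src_eq_inl {B : Set V} {e : E} {v : V} :
    (G.cut B).src e = Sum.inl v ↔ G.src e = v := by
  simp [cut]

theorem cut_src_ne_inr {B : Set V} {e : E} {b : B} : (G.cut B).src e ≠ Sum.inr b := by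
  simp [cut]

variable [Fintype E]

theorem sum_filter_congr_iff {p q : E → Prop} {_ : DecidablePred p} {_ : DecidablePred q}
    (h : ∀ e, p e ↔ q e) (f : E → ℂ) : ∑ e with p e, f e = ∑ e with q e, f e :=
  Finset.sum_congr (Finset.filter_congr fun e _ => h e) fun _ _ => rfl

theorem sum_filter_eq_single {p : E → Prop} {_ : DecidablePred p} {e₀ : E}
    (h : ∀ e, p e ↔ e = e₀) (f : E → ℂ) : ∑ e with p e, f e = f e₀ := by
  have : Finset.univ.filter p = {e₀} := by ext e; simp [h]
  rw [this, Finset.sum_singleton]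

theorem sum_filter_eq_zero {p : E → Prop} {_ : DecidablePred p} (h : ∀ e, ¬ p e) (f : E → ℂ) :
    ∑ e with p e, f e = 0 := by
  rw [Finset.filter_false_of_mem fun e _ => h e, Finset.sum_empty]

theorem normalSum_cut_of_notMem {B : Set V} {v : V} (hv : v ∉ B) (p q : E → ℂ) :
    normalSum (G.cut B).src (G.cut B).tgt p q (Sum.inl v) = normalSum G.src G.tgt p q v := by
  exact congrArg₂ (· - ·)
    (sum_filter_congr_iff (fun e => G.cut_tgt_eq_inl.trans (and_iff_left hv)) q)
    (sum_filter_congr_iff (fun e => G.cut_src_eq_inl) p)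

theorem normalSum_of_ends {v : V} {e₁ e₂ : E} (h₁ : ∀ e, G.tgt e = v ↔ e = e₁)
    (h₂ : ∀ e, G.src e = v ↔ e = e₂) (p q : E → ℂ) :
    normalSum G.src G.tgt p q v = q e₁ - p e₂ := by
  rw [normalSum, sum_filter_eq_single h₁, sum_filter_eq_single h₂]

theorem normalSum_cut_inl {B : Set V} {v : V} (hv : v ∈ B) {e₂ : E}
    (h₂ : ∀ e, G.src e = v ↔ e = e₂) (p q : E → ℂ) :
    normalSum (G.cut B).src (G.cut B).tgt p q (Sum.inl v) = -p e₂ := by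
  rw [← zero_sub]
  exact congrArg₂ (· - ·) (sum_filter_eq_zero (fun e h => (G.cut_tgt_eq_inl.1 h).2 hv) q)
    (sum_filter_eq_single (fun e => G.cut_src_eq_inl.trans (h₂ e)) p)

theorem normalSum_cut_inr {B : Set V} {b : B} {e₁ : E}
    (h₁ : ∀ e, G.tgt e = b ↔ e = e₁) (p q : E → ℂ) :
    normalSum (G.cut B).src (G.cut B).tgt p q (Sum.inr b) = q e₁ := by
  rw [← sub_zero (q e₁)]
  exact congrArg₂ (· - ·) (sum_filter_eq_single (fun e => G.cut_tgt_eq_inr.trans (h₁ e)) q)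
    (sum_filter_eq_zero (fun e => G.cut_src_ne_inr) p)

theorem kirchhoffAt_iff (v : V) (u u' : E → ℝ → ℂ) : G.KirchhoffAt v u u' ↔
    (∃ c : ℂ, (∀ e, G.src e = v → u e 0 = c) ∧ (∀ e, G.tgt e = v → u e (G.len e) = c)) ∧
    normalSum G.src G.tgt (fun e => u' e 0) (fun e => u' e (G.len e)) v = 0 := by
  rw [KirchhoffAt, normalSum, sub_eq_zero, sub_eq_zero]
  exact and_congr_right fun _ => eq_comm

variable {G} {B : Set V}

theorem mem_deltaGraph_zero (hdeg : ∀ v ∈ B, G.degree v = 2)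
    (horient : ∀ v ∈ B, (∃ e, G.tgt e = v) ∧ ∃ e, G.src e = v) (p : G.L2 × G.L2) :
    p ∈ G.deltaGraph (Real.pi / 2) B 0 ↔ IsCoupledSolution G.src G.tgt G.len 0 p := by
  refine exists_congr fun u => exists_congr fun u' => and_congr_right fun _ => ?_
  have hB : ∀ v ∈ B, (G.DeltaAt (Real.pi / 2) 0 v u u' ↔ G.KirchhoffAt v u u') := fun v hv => by
    obtain ⟨e₁, e₂, h₁, h₂⟩ := G.exists_unique_ends (hdeg v hv) (horient v hv)
    rw [kirchhoffAt_iff, G.normalSum_of_ends h₁ h₂]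
    simp only [DeltaAt, h₁, h₂, deltaCond_zero, forall_eq, forall_eq_apply_imp_iff]
    constructor
    · rintro ⟨h3, h4⟩
      exact ⟨⟨u e₂ 0, rfl, h4⟩, sub_eq_zero.2 h3⟩
    · rintro ⟨⟨c, h3, h4⟩, h5⟩
      exact ⟨sub_eq_zero.1 h5, h4.trans h3.symm⟩
  have hall : ((∀ v ∈ B, G.DeltaAt (Real.pi / 2) 0 v u u') ∧ ∀ v ∉ B, G.KirchhoffAt v u u') ↔
      ∀ v, G.KirchhoffAt v u u' := by
    constructor
    · rintro ⟨h1, h2⟩ v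
      by_cases hv : v ∈ B
      · exact (hB v hv).1 (h1 v hv)
      · exact h2 v hv
    · exact fun h => ⟨fun v hv => (hB v hv).2 (h v), fun v _ => h v⟩
  rw [hall]
  simp only [kirchhoffAt_iff]
  constructor
  · intro h
    choose φ hφ using fun v => (h v).1
    exact ⟨φ, fun e => (hφ (G.src e)).1 e rfl, fun e => (hφ (G.tgt e)).2 e rfl,
      funext fun v => (h v).2⟩
  · rintro ⟨φ, h1, h2, h3⟩ v
    exact ⟨⟨φ v, fun e he => he ▸ h1 e, fun e he => he ▸ h2 e⟩, congrFun h3 v⟩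

/-- The two copies of a cut vertex carry the two one-sided values. The outward derivatives there are
`f₁'` and `-f₂'`, so the `δ'` condition equates them with `±t⁻¹ (f₁ - f₂)`. -/
theorem mem_deltaGraph_of_pos (hdeg : ∀ v ∈ B, G.degree v = 2)
    (horient : ∀ v ∈ B, (∃ e, G.tgt e = v) ∧ ∃ e, G.src e = v) {t : EReal} (ht : 0 < t)
    (p : G.L2 × G.L2) :
    p ∈ G.deltaGraph (Real.pi / 2) B t ↔ IsCoupledSolution (G.cut B).src (G.cut B).tgt G.len
      (((t.toReal⁻¹ : ℝ) : ℂ) • jumpCoupling B) p := by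
  classical
  refine exists_congr fun u => exists_congr fun u' => and_congr_right fun _ => ?_
  choose e₁ e₂ h₁ h₂ using fun v (hv : v ∈ B) =>
    G.exists_unique_ends (hdeg v hv) (horient v hv)
  have hdelta : ∀ v (hv : v ∈ B), (G.DeltaAt (Real.pi / 2) t v u u' ↔
      u' (e₁ v hv) (G.len (e₁ v hv)) =
        ((t.toReal⁻¹ : ℝ) : ℂ) * (u (e₁ v hv) (G.len (e₁ v hv)) - u (e₂ v hv) 0) ∧
      u' (e₂ v hv) 0 = ((t.toReal⁻¹ : ℝ) : ℂ) * (u (e₁ v hv) (G.len (e₁ v hv)) - u (e₂ v hv) 0)) :=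
    fun v hv => by
      rw [← deltaCond_of_pos ht]
      exact ⟨fun h => h _ _ ((h₁ v hv _).2 rfl) ((h₂ v hv _).2 rfl), fun h f₁ f₂ hf₁ hf₂ => by
        rw [h₁ v hv] at hf₁
        rw [h₂ v hv] at hf₂
        rw [hf₁, hf₂]
        exact h⟩
  constructor
  · rintro ⟨hB, hK⟩
    simp only [kirchhoffAt_iff] at hK
    choose! c hc using fun v hv => (hK v hv).1
    let φ : V ⊕ B → ℂ := Sum.elim (fun v => if hv : v ∈ B then u (e₂ v hv) 0 else c v)
      fun b => u (e₁ b b.2) (G.len (e₁ b b.2))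
    refine ⟨φ, fun e => ?_, fun e => ?_, ?_⟩
    · by_cases hv : G.src e ∈ B
      · have : e = e₂ (G.src e) hv := (h₂ _ hv e).1 rfl
        simp [φ, cut, hv, ← this]
      · simp [φ, cut, hv, (hc _ hv).1 e rfl]
    · by_cases hv : G.tgt e ∈ B
      · have : e = e₁ (G.tgt e) hv := (h₁ _ hv e).1 rfl
        simp [φ, cut, hv, ← this]
      · simp [φ, cut, hv, (hc _ hv).2 e rfl]
    · ext (v | ⟨v, hv⟩)
      · by_cases hv : v ∈ B
        · rw [G.normalSum_cut_inl hv (h₂ v hv), ((hdelta v hv).1 (hB v hv)).2,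
            LinearMap.smul_apply, Pi.smul_apply, jumpCoupling_inl hv]
          simp [φ, hv]
          ring
        · rw [G.normalSum_cut_of_notMem hv, (hK v hv).2, LinearMap.smul_apply, Pi.smul_apply,
            jumpCoupling_inl_of_notMem hv, smul_zero]
      · rw [G.normalSum_cut_inr (h₁ v hv), ((hdelta v hv).1 (hB v hv)).1,
          LinearMap.smul_apply, Pi.smul_apply, jumpCoupling_inr]
        simp [φ, hv]
  · rintro ⟨φ, h3, h4, h5⟩
    refine ⟨fun v hv => (hdelta v hv).2 ?_, fun v hv => (kirchhoffAt_iff ..).2 ⟨⟨φ (Sum.inl v),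
      fun e he => ?_, fun e he => ?_⟩, ?_⟩⟩
    · have h6 := congrFun h5 (Sum.inl v)
      have h7 := congrFun h5 (Sum.inr ⟨v, hv⟩)
      rw [G.normalSum_cut_inl hv (h₂ v hv), LinearMap.smul_apply, Pi.smul_apply,
        jumpCoupling_inl hv, smul_eq_mul] at h6
      rw [G.normalSum_cut_inr (h₁ v hv), LinearMap.smul_apply, Pi.smul_apply,
        jumpCoupling_inr, smul_eq_mul] at h7
      rw [h3, h4, G.cut_tgt_eq_inr (b := ⟨v, hv⟩) |>.2 ((h₁ v hv _).2 rfl),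
        G.cut_src_eq_inl.2 ((h₂ v hv _).2 rfl)]
      exact ⟨h7, by linear_combination -h6⟩
    · rw [h3, G.cut_src_eq_inl.2 he]
    · rw [h4, G.cut_tgt_eq_inl.2 ⟨he, hv⟩]
    · rw [← G.normalSum_cut_of_notMem hv, h5, LinearMap.smul_apply, Pi.smul_apply,
        jumpCoupling_inl_of_notMem hv, smul_zero]

end MetricGraph

/-! ### Counting eigenvalues along the `δ'` family -/

namespace MetricGraph

open Module Filter Topology

variable {V E : Type*}

/-- The graph may be cut at `B`, has no isolated vertices, and eigenfunctions with eigenvalue at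
most `b` are determined by their vertex values. -/
structure IsAdmissible (G : MetricGraph V E) (B : Set V) (b : ℝ) : Prop where
  degree : ∀ v ∈ B, G.degree v = 2
  orient : ∀ v ∈ B, (∃ e, G.tgt e = v) ∧ ∃ e, G.src e = v
  ends : ∀ v, ∃ e, G.src e = v ∨ G.tgt e = v
  bound : ∀ e, √b * G.len e < Real.pi / 2

section

variable {G : MetricGraph V E} {B : Set V} {b : ℝ}

theorem IsAdmissible.cut_ends (h : G.IsAdmissible B b) (w : V ⊕ B) :
    ∃ e, (G.cut B).src e = w ∨ (G.cut B).tgt e = w := by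
  obtain v | v := w
  · by_cases hv : v ∈ B
    · obtain ⟨-, e, he⟩ := h.orient v hv
      exact ⟨e, Or.inl (G.cut_src_eq_inl.2 he)⟩
    · obtain ⟨e, he | he⟩ := h.ends v
      · exact ⟨e, Or.inl (G.cut_src_eq_inl.2 he)⟩
      · exact ⟨e, Or.inr (G.cut_tgt_eq_inl.2 ⟨he, hv⟩)⟩
  · obtain ⟨⟨e, he⟩, -⟩ := h.orient v v.2
    exact ⟨e, Or.inr (G.cut_tgt_eq_inr.2 he)⟩

theorem IsAdmissible.bound_of_le (h : G.IsAdmissible B b) {μ : ℝ} (hμ : μ ≤ b) (e : E) :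
    √μ * G.len e < Real.pi / 2 :=
  (mul_le_mul_of_nonneg_right (Real.sqrt_le_sqrt hμ) (G.len_pos e).le).trans_lt (h.bound e)

end

variable [Fintype E]

/-- The Dirichlet-to-Neumann map of the cut graph with attraction `c` between the two copies of
the cut vertices. -/
def cutMap (G : MetricGraph V E) (B : Set V) (μ c : ℝ) : (V ⊕ B → ℂ) →ₗ[ℂ] (V ⊕ B → ℂ) :=
  dtn (G.cut B).src (G.cut B).tgt G.len μ - (c : ℂ) • jumpCoupling B

/-- The multiplicity of `μ` for the parameter `t`, read off from the vertex values. -/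
def vertexKer (G : MetricGraph V E) (B : Set V) (t : EReal) (μ : ℝ) : ℕ :=
  open Classical in
  if t = 0 then finrank ℂ (LinearMap.ker (dtn G.src G.tgt G.len μ))
  else finrank ℂ (LinearMap.ker (G.cutMap B μ t.toReal⁻¹))

/-- The number of eigenvalues below `μ` for the parameter `t`; at `t = 0` the eigenvalues at `-∞`
are included. -/
def levelIndex (G : MetricGraph V E) (B : Set V) [Fintype V] [Fintype B] (t : EReal) (μ : ℝ) : ℕ :=
  open Classical in
  if t = 0 then negIndex (quadForm (dtn G.src G.tgt G.len μ)) + Fintype.card B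
  else negIndex (quadForm (G.cutMap B μ t.toReal⁻¹))

variable {G : MetricGraph V E} {B : Set V} {b : ℝ}

theorem mem_graph_deltaOp {α : ℝ} {t : EReal} {p : G.L2 × G.L2} :
    p ∈ (G.deltaOp α B t).graph ↔ p ∈ G.deltaGraph α B t := by
  rw [deltaOp_graph]

theorem IsAdmissible.finrank_eigenspace [Finite V] (h : G.IsAdmissible B b) {t : EReal}
    (ht : 0 ≤ t) {μ : ℝ} (hμ : μ ≤ b) :
    finrank ℂ (graphEigenspace (G.deltaOp (Real.pi / 2) B t).graph μ) = G.vertexKer B t μ := by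
  rw [vertexKer]
  split_ifs with h0
  · subst h0
    rw [finrank_graphEigenspace G.len_pos h.ends (h.bound_of_le hμ)
      fun p => mem_graph_deltaOp.trans (mem_deltaGraph_zero h.degree h.orient p), sub_zero]
  · exact finrank_graphEigenspace G.len_pos h.cut_ends (h.bound_of_le hμ)
      fun p => mem_graph_deltaOp.trans
        (mem_deltaGraph_of_pos h.degree h.orient (lt_of_le_of_ne ht (Ne.symm h0)) p)

theorem IsAdmissible.dimKer_eq [Finite V] (h : G.IsAdmissible B b) {t : EReal}
    (ht : 0 ≤ t) {μ : ℝ} (hμ : μ ≤ b) :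
    dimKer (G.deltaOp (Real.pi / 2) B t) μ = G.vertexKer B t μ := by
  rw [dimKer_eq_finrank, h.finrank_eigenspace ht hμ]

theorem IsAdmissible.vertexKer_eq_zero [Finite V] (h : G.IsAdmissible B b) {t : EReal}
    (ht : 0 ≤ t) {μ : ℝ} (hμ : μ ≤ b)
    (hs : (μ : ℂ) ∉ unboundedSpectrum (G.deltaOp (Real.pi / 2) B t)) :
    G.vertexKer B t μ = 0 := by
  rw [← h.finrank_eigenspace ht hμ, finrank_eigenspace_of_notMem_spectrum hs]

theorem IsAdmissible.notMem_spectrum [Finite V] (h : G.IsAdmissible B b) {t : EReal}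
    (ht : 0 ≤ t) {μ : ℝ} (hμ : μ ≤ b) (hk : G.vertexKer B t μ = 0) :
    (μ : ℂ) ∉ unboundedSpectrum (G.deltaOp (Real.pi / 2) B t) := by
  rw [vertexKer] at hk
  split_ifs at hk with h0
  · subst h0
    exact notMem_spectrum_of_finrank_ker G.len_pos (h.bound_of_le hμ) (X := 0)
      (fun p => mem_graph_deltaOp.trans (mem_deltaGraph_zero h.degree h.orient p))
      (by rwa [sub_zero])
  · exact notMem_spectrum_of_finrank_ker G.len_pos (h.bound_of_le hμ)
      (fun p => mem_graph_deltaOp.trans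
        (mem_deltaGraph_of_pos h.degree h.orient (lt_of_le_of_ne ht (Ne.symm h0)) p)) hk

variable [Fintype V] [Fintype B]

theorem isHermitianMap_cutMap (μ c : ℝ) : IsHermitianMap (G.cutMap B μ c) :=
  (isHermitianMap_dtn _ _ _ μ).sub_smul isHermitianMap_jumpCoupling c

theorem quadForm_cutMap (μ c : ℝ) (x : V ⊕ B → ℂ) : quadForm (G.cutMap B μ c) x =
    quadForm (dtn (G.cut B).src (G.cut B).tgt G.len μ) x - c * quadForm (jumpCoupling B) x :=
  quadForm_sub_smul _ _ c x

theorem IsAdmissible.finsum_vertexKer (h : G.IsAdmissible B b) (t : EReal) {lo hi : ℝ}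
    (hlo : lo ≤ hi) (hhi : hi ≤ b) :
    (Icc lo hi ∩ Function.support (G.vertexKer B t)).Finite ∧
      ∑ᶠ μ ∈ Ico lo hi, (G.vertexKer B t μ : ℤ) =
        (G.levelIndex B t hi : ℤ) - G.levelIndex B t lo := by
  unfold vertexKer levelIndex
  split_ifs with h0
  · have := finsum_finrank_ker (isHermitianMap_dtn G.src G.tgt G.len) hlo
      (fun s hs y => continuousAt_quadForm_dtn G.len_pos (h.bound_of_le (hs.2.trans hhi)) y)
      (fun s hs r hr hsr x hx => quadForm_dtn_strictAnti G.len_pos h.ends hsr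
        (h.bound_of_le (hr.2.trans hhi)) hx)
    refine ⟨this.1, this.2.trans ?_⟩
    push_cast
    ring
  · refine finsum_finrank_ker (fun μ => isHermitianMap_cutMap μ t.toReal⁻¹) hlo
      (fun s hs y => ?_) (fun s hs r hr hsr x hx => ?_)
    · simp only [quadForm_cutMap]
      refine ContinuousAt.sub
        (continuousAt_quadForm_dtn G.len_pos (h.bound_of_le (hs.2.trans hhi)) y)
        (Continuous.continuousAt ?_)
      exact continuous_const.mul ((continuous_quadForm _).comp continuous_snd)
    · simp only [quadForm_cutMap]
      have := quadForm_dtn_strictAnti G.len_pos h.cut_ends hsr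
        (h.bound_of_le (hr.2.trans hhi)) hx
      linarith

/-- Below the top of the admissible range every interval contains a regular value. -/
theorem IsAdmissible.exists_regular (h : G.IsAdmissible B b) (t : EReal) {lo hi : ℝ}
    (hlo : lo < hi) (hhi : hi ≤ b) : ∃ μ ∈ Ioo lo hi, G.vertexKer B t μ = 0 := by
  obtain ⟨μ, hμ, hμ'⟩ :=
    ((Ioo_infinite hlo).sdiff (h.finsum_vertexKer t hlo.le hhi).1).nonempty
  refine ⟨μ, hμ, ?_⟩
  by_contra hne
  exact hμ' ⟨Ioo_subset_Icc_self hμ, hne⟩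

/-- The behaviour as `t → 0`: strong coupling separates the functions without jump, on which the
form is that of the uncut graph, from one additional negative direction for each cut vertex. -/
theorem eventually_cutMap (μ : ℝ)
    (hk : finrank ℂ (LinearMap.ker (dtn G.src G.tgt G.len μ)) = 0) :
    ∀ᶠ c in atTop, finrank ℂ (LinearMap.ker (G.cutMap B μ c)) = 0 ∧
      negIndex (quadForm (G.cutMap B μ c)) =
        negIndex (quadForm (dtn G.src G.tgt G.len μ)) + Fintype.card B := by
  -- `I` gives both copies of a cut vertex the same value; `U` produces arbitrary jumps by changing
  -- the `inr` copies only.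
  let I : (V → ℂ) →ₗ[ℂ] (V ⊕ B → ℂ) := LinearMap.funLeft ℂ ℂ (Sum.elim id Subtype.val)
  let U : (B → ℂ) →ₗ[ℂ] (V ⊕ B → ℂ) :=
    { toFun := fun y => Sum.elim 0 y
      map_add' := fun x y => by ext (v | v) <;> simp
      map_smul' := fun c x => by ext (v | v) <;> simp }
  have hsrc : ∀ e, Sum.elim id Subtype.val ((G.cut B).src e) = G.src e := fun e => rfl
  have htgt : ∀ e, Sum.elim id Subtype.val ((G.cut B).tgt e) = G.tgt e := fun e => by
    simp only [cut]
    split_ifs <;> rfl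
  refine eventually_negIndex_coupling (I := I) (U := U) (isHermitianMap_dtn _ _ _ μ)
    (isHermitianMap_cutMap μ) (by simp) ?_ ?_ (continuous_quadForm _) (continuous_quadForm _)
    (fun x => ?_) (quadForm_cutMap μ) (fun x y hxy => ?_) (fun x => ?_) (fun x => ?_) hk
  · intro x y hxy
    ext v
    exact congrFun hxy (Sum.inl v)
  · intro x y hxy
    ext v
    exact congrFun hxy (Sum.inr v)
  · rw [quadForm_jumpCoupling]
    positivity
  · rw [quadForm_jumpCoupling, Finset.sum_eq_zero_iff_of_nonneg fun _ _ => by positivity] at hxy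
    ext v
    simpa [I, U, LinearMap.funLeft_apply] using hxy v (Finset.mem_univ v)
  · rw [quadForm_jumpCoupling]
    simp [I, LinearMap.funLeft_apply]
  · rw [quadForm_dtn, quadForm_dtn]
    simp only [I, LinearMap.funLeft_apply, hsrc, htgt]

/-- Couplings between those of the end points come from parameters in the piece. When the piece
starts at zero there is no upper bound on `c`, hence the conditional hypothesis. -/
theorem exists_inv_toReal_eq {r s : EReal} (hs : 0 < s) {c : ℝ} (hc : s.toReal⁻¹ ≤ c)
    (hr : 0 < r → c ≤ r.toReal⁻¹) : ∃ q, r ≤ q ∧ q ≤ s ∧ 0 < q ∧ q.toReal⁻¹ = c := by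
  have hc0 : 0 ≤ c := (inv_nonneg.2 (EReal.toReal_nonneg hs.le)).trans hc
  rcases hc0.eq_or_lt with rfl | hc0
  · have : s = ⊤ := by
      induction s with
      | bot => simp at hs
      | top => rfl
      | coe x =>
        have hx : 0 < x := by exact_mod_cast hs
        simp only [EReal.toReal_coe] at hc
        exact absurd hc (not_le.2 (inv_pos.2 hx))
    exact ⟨⊤, le_top, this.ge, by simp, by simp⟩
  · refine ⟨((c⁻¹ : ℝ) : EReal), ?_, ?_, by exact_mod_cast inv_pos.2 hc0, by simp⟩
    · by_cases hr0 : 0 < r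
      · have hr := hr hr0
        induction r with
        | bot => simp
        | top => simp at hr; linarith
        | coe x =>
          have hx : 0 < x := by exact_mod_cast hr0
          rw [EReal.toReal_coe] at hr
          exact_mod_cast (le_inv_comm₀ hx hc0).2 hr
      · exact (not_lt.1 hr0).trans (by exact_mod_cast (inv_pos.2 hc0).le)
    · induction s with
      | bot => simp at hs
      | top => exact le_top
      | coe x =>
        have hx : 0 < x := by exact_mod_cast hs
        rw [EReal.toReal_coe] at hc
        exact_mod_cast (inv_le_comm₀ hx hc0).1 hc

theorem negIndex_cutMap_eq {μ : ℝ} {I : Set ℝ} (hI : IsPreconnected I)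
    (hk : ∀ c ∈ I, finrank ℂ (LinearMap.ker (G.cutMap B μ c)) = 0) {c d : ℝ} (hc : c ∈ I)
    (hd : d ∈ I) :
    negIndex (quadForm (G.cutMap B μ c)) = negIndex (quadForm (G.cutMap B μ d)) := by
  refine negIndex_eq_of_isPreconnected (isHermitianMap_cutMap μ) ?_ hI hk hc hd
  simp only [quadForm_cutMap]
  exact ((continuous_quadForm _).comp continuous_snd).sub
    (continuous_fst.mul ((continuous_quadForm _).comp continuous_snd))

/-- The counting function does not change along a piece on which `μ` is regular. -/
theorem levelIndex_eq {r s : EReal} (hr : 0 ≤ r) (hrs : r ≤ s) {μ : ℝ}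
    (hk : ∀ q ∈ Icc r s, G.vertexKer B q μ = 0) : G.levelIndex B r μ = G.levelIndex B s μ := by
  rcases hrs.eq_or_lt with rfl | hlt
  · rfl
  have hs : 0 < s := hr.trans_lt hlt
  have hkc : ∀ c, s.toReal⁻¹ ≤ c → (0 < r → c ≤ r.toReal⁻¹) →
      finrank ℂ (LinearMap.ker (G.cutMap B μ c)) = 0 := fun c hc hc' => by
    obtain ⟨q, hq1, hq2, hq3, rfl⟩ := exists_inv_toReal_eq hs hc hc'
    have := hk q ⟨hq1, hq2⟩
    rwa [vertexKer, if_neg hq3.ne'] at this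
  rcases hr.eq_or_lt with rfl | hr
  · rw [levelIndex, levelIndex, if_pos rfl, if_neg hs.ne']
    have h0 := hk 0 ⟨le_rfl, hrs⟩
    rw [vertexKer, if_pos rfl] at h0
    -- A piece starting at zero corresponds to all couplings in `[s⁻¹, ∞)`. The index is constant
    -- there and is read off at a large coupling, where it agrees with the value assigned at zero.
    obtain ⟨c, hc, hc'⟩ := ((eventually_cutMap (B := B) μ h0).and
      (eventually_ge_atTop s.toReal⁻¹)).exists
    rw [← hc.2]
    exact negIndex_cutMap_eq isPreconnected_Ici
      (fun c hc => hkc c hc fun h => absurd h (lt_irrefl _)) hc' (mem_Ici.2 le_rfl)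
  · rw [levelIndex, levelIndex, if_neg hr.ne', if_neg hs.ne']
    have hle : s.toReal⁻¹ ≤ r.toReal⁻¹ := by
      by_cases hs' : s = ⊤
      · rw [hs']
        simpa using EReal.toReal_nonneg hr.le
      · have h1 : 0 < r.toReal := EReal.toReal_pos hr (hlt.trans_le le_top).ne
        exact inv_anti₀ h1 (EReal.toReal_le_toReal hrs (bot_lt_iff_ne_bot.1
          ((EReal.bot_lt_zero).trans hr)) hs')
    exact negIndex_cutMap_eq isPreconnected_Icc (fun c hc => hkc c hc.1 fun _ => hc.2)
      (right_mem_Icc.2 hle) (left_mem_Icc.2 hle)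

end MetricGraph

/-! ### Existence of partitions and the value of the spectral flow -/

section Parametrization

/-- The increasing parametrization `x ↦ x / (1 - x)` of `[0, ∞]` by `[0, 1]`. -/
def flowParam (x : ℝ) : EReal := if x < 1 then ((x / (1 - x) : ℝ) : EReal) else ⊤

theorem flowParam_zero : flowParam 0 = 0 := by simp [flowParam]

theorem flowParam_one : flowParam 1 = ⊤ := by simp [flowParam]

theorem flowParam_inv {x : ℝ} (hx : x ≤ 1) : (flowParam x).toReal⁻¹ = (1 - x) / x := by
  rw [flowParam]
  split_ifs with h
  · simp
  · have : x = 1 := le_antisymm hx (not_lt.1 h)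
    simp [this]

theorem flowParam_strictMonoOn : StrictMonoOn flowParam (Icc 0 1) := by
  intro x hx y hy hxy
  have hx1 : x < 1 := hxy.trans_le hy.2
  rw [flowParam, if_pos hx1, flowParam]
  split_ifs with h
  · rw [EReal.coe_lt_coe_iff, div_lt_div_iff₀ (by linarith) (by linarith)]
    nlinarith
  · exact EReal.coe_lt_top _

theorem flowParam_surjOn {s : EReal} (hs : 0 ≤ s) : ∃ x ∈ Icc (0 : ℝ) 1, flowParam x = s := by
  induction s with
  | bot => simp at hs
  | top => exact ⟨1, ⟨zero_le_one, le_rfl⟩, flowParam_one⟩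
  | coe r =>
    have hr : 0 ≤ r := by exact_mod_cast hs
    have h1 : r / (1 + r) < 1 := by rw [div_lt_one (by linarith)]; linarith
    refine ⟨r / (1 + r), ⟨by positivity, h1.le⟩, ?_⟩
    rw [flowParam, if_pos h1]
    congr 1
    field_simp
    ring

end Parametrization

namespace MetricGraph

open Module Filter Topology

variable {V E : Type*} [Fintype E] {G : MetricGraph V E} {B : Set V} {b : ℝ}

section

variable [Fintype V] [Fintype B]

/-- Regularity of `μ` is an open condition on the parameter. -/
theorem eventually_vertexKer {μ x₀ : ℝ} (hx₀ : x₀ ∈ Icc (0 : ℝ) 1)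
    (hk : G.vertexKer B (flowParam x₀) μ = 0) :
    ∀ᶠ x in 𝓝 x₀, x ∈ Icc (0 : ℝ) 1 → G.vertexKer B (flowParam x) μ = 0 := by
  have hpos : ∀ x ∈ Icc (0 : ℝ) 1, 0 < x → G.vertexKer B (flowParam x) μ =
      finrank ℂ (LinearMap.ker (G.cutMap B μ ((1 - x) / x))) := fun x hx h0 => by
    have : flowParam x ≠ 0 := by
      rw [← flowParam_zero]
      exact (flowParam_strictMonoOn ⟨le_rfl, zero_le_one⟩ hx h0).ne'
    rw [vertexKer, if_neg this, flowParam_inv hx.2]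
  rcases hx₀.1.eq_or_lt with rfl | h0
  · have hk0 := hk
    rw [flowParam_zero, vertexKer, if_pos rfl] at hk
    -- At the left end openness comes from the strong coupling limit, as `cutMap` has no continuous
    -- extension to infinite coupling.
    have hlim : Tendsto (fun x : ℝ => (1 - x) / x) (𝓝[>] 0) atTop := by
      have h1 : Tendsto (fun x : ℝ => x⁻¹ - 1) (𝓝[>] 0) atTop :=
        tendsto_atTop_add_const_right _ (-1) tendsto_inv_nhdsGT_zero
      refine h1.congr' ?_
      filter_upwards [self_mem_nhdsWithin] with x hx
      have : x ≠ 0 := (mem_Ioi.1 hx).ne'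
      field_simp
    have := eventually_nhdsWithin_iff.1 (hlim.eventually (eventually_cutMap (B := B) μ hk))
    filter_upwards [this] with x hx hxI
    rcases hxI.1.eq_or_lt with rfl | h0
    · exact hk0
    · rw [hpos x hxI h0]
      exact (hx h0).1
  · rw [hpos x₀ hx₀ h0] at hk
    have hc : ∀ y, ContinuousAt (fun p : ℝ × (V ⊕ B → ℂ) =>
        quadForm (G.cutMap B μ ((1 - p.1) / p.1)) p.2) (x₀, y) := fun y => by
      simp only [quadForm_cutMap]
      have h1 : ContinuousAt (fun p : ℝ × (V ⊕ B → ℂ) => (1 - p.1) / p.1) (x₀, y) :=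
        ContinuousAt.div (by fun_prop) (by fun_prop) h0.ne'
      exact ((continuous_quadForm _).comp continuous_snd).continuousAt.sub
        (h1.mul ((continuous_quadForm _).comp continuous_snd).continuousAt)
    filter_upwards [eventually_negIndex_le (T := fun x : ℝ => G.cutMap B μ ((1 - x) / x)) hc,
      eventually_negIndex_add_ker_le (T := fun x : ℝ => G.cutMap B μ ((1 - x) / x))
        (fun x => isHermitianMap_cutMap μ _) hc, lt_mem_nhds h0] with x h1 h2 h3 hxI
    rw [hpos x hxI h3]
    omega

/-- Every parameter has regular levels on both sides of `ε`, since only finitely many eigenvalues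
lie in a bounded interval below `b`. The same levels serve a neighbourhood of the parameter, and a
Lebesgue number of this cover of the compact parameter interval bounds the mesh. -/
theorem IsAdmissible.nonempty_flowPartition (h : G.IsAdmissible B b) {ε : ℝ} (hε : ε < b) :
    Nonempty (FlowPartition (fun t : EReal => G.deltaOp (Real.pi / 2) B t) 0 ⊤ ε) := by
  let good : ℝ × ℝ → Set ℝ := fun w => {x | x ∈ Icc (0 : ℝ) 1 →
    G.vertexKer B (flowParam x) w.1 = 0 ∧ G.vertexKer B (flowParam x) w.2 = 0}
  let ι := {w : ℝ × ℝ // w.1 < ε ∧ ε < w.2 ∧ w.2 ≤ b}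
  have hcover : Icc (0 : ℝ) 1 ⊆ ⋃ w : ι, interior (good w.1) := fun x hx => by
    obtain ⟨lo, hlo, hlo'⟩ := h.exists_regular (flowParam x) (sub_one_lt ε) hε.le
    obtain ⟨hi, hhi, hhi'⟩ := h.exists_regular (flowParam x) hε le_rfl
    refine mem_iUnion.2 ⟨⟨(lo, hi), hlo.2, hhi.1, hhi.2.le⟩, mem_interior_iff_mem_nhds.2 ?_⟩
    filter_upwards [eventually_vertexKer hx hlo', eventually_vertexKer hx hhi'] with y h1 h2 hy
    exact ⟨h1 hy, h2 hy⟩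
  obtain ⟨δ, hδ, hball⟩ := lebesgue_number_lemma_of_metric isCompact_Icc
    (fun w : ι => isOpen_interior) hcover
  obtain ⟨n, hn⟩ := exists_nat_one_div_lt hδ
  have hn0 : (0 : ℝ) < n + 1 := by positivity
  let x : Fin (n + 1 + 1) → ℝ := fun i => (i : ℕ) / ((n : ℝ) + 1)
  have hxI : ∀ i, x i ∈ Icc (0 : ℝ) 1 := fun i => by
    refine ⟨by positivity, ?_⟩
    rw [div_le_one hn0]
    exact_mod_cast Nat.lt_succ_iff.1 i.2
  have hxmono : StrictMono x := fun i j hij => by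
    have : (i : ℕ) < (j : ℕ) := hij
    exact div_lt_div_of_pos_right (by exact_mod_cast this) hn0
  choose w hw using fun l : Fin (n + 1) => hball (x l.castSucc) (hxI _)
  have hreg : ∀ l : Fin (n + 1), ∀ s ∈ Icc (flowParam (x l.castSucc)) (flowParam (x l.succ)),
      0 ≤ s ∧ G.vertexKer B s (w l).1.1 = 0 ∧ G.vertexKer B s (w l).1.2 = 0 := fun l s hs => by
    have h0 : (0 : EReal) ≤ s := by
      refine le_trans ?_ hs.1
      rw [← flowParam_zero]
      exact flowParam_strictMonoOn.monotoneOn ⟨le_rfl, zero_le_one⟩ (hxI _) (hxI _).1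
    obtain ⟨y, hy, rfl⟩ := flowParam_surjOn h0
    have h1 := (flowParam_strictMonoOn.le_iff_le (hxI _) hy).1 hs.1
    have h2 := (flowParam_strictMonoOn.le_iff_le hy (hxI _)).1 hs.2
    have h3 : x l.succ = x l.castSucc + 1 / ((n : ℝ) + 1) := by
      simp only [x, Fin.val_succ, Fin.val_castSucc]
      push_cast
      ring
    refine ⟨h0, interior_subset (hw l ?_) hy⟩
    rw [Metric.mem_ball, Real.dist_eq, abs_of_nonneg (by linarith)]
    linarith
  exact ⟨{
    N := n + 1
    t := fun i => flowParam (x i)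
    strictMono := fun i j hij => flowParam_strictMonoOn (hxI i) (hxI j) (hxmono hij)
    first := by simp [x, flowParam_zero]
    last := by
      have : x (Fin.last (n + 1)) = 1 := by
        simp only [x, Fin.val_last]
        push_cast
        exact div_self hn0.ne'
      rw [this, flowParam_one]
    lo := fun l => (w l).1.1
    hi := fun l => (w l).1.2
    lo_lt := fun l => (w l).2.1
    lt_hi := fun l => (w l).2.2.1
    lo_notMem := fun l s hs => h.notMem_spectrum (hreg l s hs).1
      ((w l).2.1.le.trans hε.le) (hreg l s hs).2.1
    hi_notMem := fun l s hs => h.notMem_spectrum (hreg l s hs).1 (w l).2.2.2 (hreg l s hs).2.2 }⟩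

/-- In each window eigenvalues are counted as index at `ε` minus index at `lo`. The latter is the
same at both ends of the piece because `lo` stays regular, so the sum over the pieces telescopes. -/
theorem IsAdmissible.flow_eq (h : G.IsAdmissible B b) {ε : ℝ} (hε : ε < b)
    (P : FlowPartition (fun t : EReal => G.deltaOp (Real.pi / 2) B t) 0 ⊤ ε) :
    P.flow = (G.levelIndex B 0 ε : ℤ) - G.levelIndex B ⊤ ε := by
  have hnn : ∀ i, 0 ≤ P.t i := fun i =>
    P.first.symm.le.trans (P.strictMono.monotone (Fin.zero_le i))
  have hterm : ∀ l : Fin P.N, ∑ᶠ μ ∈ Ico (P.lo l) ε,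
      ((dimKer (G.deltaOp (Real.pi / 2) B (P.t l.castSucc)) ((μ : ℝ) : ℂ) : ℤ) -
        (dimKer (G.deltaOp (Real.pi / 2) B (P.t l.succ)) ((μ : ℝ) : ℂ) : ℤ)) =
      (G.levelIndex B (P.t l.castSucc) ε : ℤ) - G.levelIndex B (P.t l.succ) ε := fun l => by
    have hlo : P.lo l ≤ b := (P.lo_lt l).le.trans hε.le
    have hfin : ∀ t, (Ico (P.lo l) ε ∩
        Function.support fun μ => (G.vertexKer B t μ : ℤ)).Finite := fun t => by
      refine (h.finsum_vertexKer t (P.lo_lt l).le hε.le).1.subset ?_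
      rintro μ ⟨h1, h2⟩
      exact ⟨Ico_subset_Icc_self h1, by simpa using h2⟩
    have h1 : ∑ᶠ μ ∈ Ico (P.lo l) ε,
        ((dimKer (G.deltaOp (Real.pi / 2) B (P.t l.castSucc)) ((μ : ℝ) : ℂ) : ℤ) -
          (dimKer (G.deltaOp (Real.pi / 2) B (P.t l.succ)) ((μ : ℝ) : ℂ) : ℤ)) =
        ∑ᶠ μ ∈ Ico (P.lo l) ε, ((G.vertexKer B (P.t l.castSucc) μ : ℤ) +
          -(G.vertexKer B (P.t l.succ) μ : ℤ)) := by
      refine finsum_mem_congr rfl fun μ hμ => ?_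
      have hμb : μ ≤ b := hμ.2.le.trans hε.le
      rw [h.dimKer_eq (hnn _) hμb, h.dimKer_eq (hnn _) hμb, sub_eq_add_neg]
    have hconst : G.levelIndex B (P.t l.castSucc) (P.lo l) =
        G.levelIndex B (P.t l.succ) (P.lo l) :=
      levelIndex_eq (hnn _) (P.strictMono.monotone (Fin.castSucc_lt_succ).le) fun q hq =>
        h.vertexKer_eq_zero ((hnn _).trans hq.1) hlo (P.lo_notMem l q hq)
    rw [h1, finsum_mem_add_distrib' (hfin _) (by rw [Function.support_fun_neg]; exact hfin _)]
    simp only [finsum_neg_distrib]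
    rw [(h.finsum_vertexKer _ (P.lo_lt l).le hε.le).2,
      (h.finsum_vertexKer _ (P.lo_lt l).le hε.le).2,
      hconst]
    ring
  rw [FlowPartition.flow, Finset.sum_congr rfl fun l _ => hterm l, Finset.sum_sub_distrib]
  -- Splitting off the first or the last term of the same sum over all partition points gives the
  -- telescoping identity.
  have h1 := Fin.sum_univ_succ fun i => (G.levelIndex B (P.t i) ε : ℤ)
  rw [Fin.sum_univ_castSucc, P.first, P.last] at h1
  linarith

end

/-! ### Betti numbers, and the graph without edges. -/

theorem exists_pos_sqrt_mul_len_lt (G : MetricGraph V E) :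
    ∃ b > 0, ∀ e, √b * G.len e < Real.pi / 2 := by
  have h1 : ∀ᶠ b in 𝓝 (0 : ℝ), ∀ e, √b * G.len e < Real.pi / 2 := by
    rw [eventually_all]
    intro e
    have hc : Continuous fun b => √b * G.len e := by fun_prop
    exact hc.continuousAt.eventually_lt_const (by simp [Real.pi_pos])
  obtain ⟨b, hb, hb'⟩ := ((h1.filter_mono nhdsWithin_le_nhds).and
    (self_mem_nhdsWithin : Ioi (0 : ℝ) ∈ 𝓝[>] 0)).exists
  exact ⟨b, hb', hb⟩

theorem betti_sub_betti_cut {V E : Type*} [Finite V] (G : MetricGraph V E) (B : Set V) :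
    G.betti - (G.cut B).betti =
      (Nat.card G.Components : ℤ) + Nat.card B - Nat.card (G.cut B).Components := by
  rw [betti, betti, Nat.card_sum]
  push_cast
  ring

/-- The presence of an edge excludes isolated vertices, whose values would be invisible in `L²` and
would spoil strict monotonicity. -/
theorem Connected.exists_end {V E : Type*} {G : MetricGraph V E} [Nonempty E]
    (hG : G.Connected) (v : V) :
    ∃ e, G.src e = v ∨ G.tgt e = v := by
  obtain ⟨e⟩ := ‹Nonempty E›
  have key : ∀ {v w : V}, Relation.EqvGen (fun v w : V => ∃ e, G.src e = v ∧ G.tgt e = w) v w →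
      v = w ∨ (∃ e, G.src e = v ∨ G.tgt e = v) ∧ ∃ e, G.src e = w ∨ G.tgt e = w := by
    intro v w h
    induction h with
    | rel v w h =>
      obtain ⟨e, h1, h2⟩ := h
      exact Or.inr ⟨⟨e, Or.inl h1⟩, e, Or.inr h2⟩
    | refl v => exact Or.inl rfl
    | symm v w _ ih => exact ih.imp Eq.symm And.symm
    | trans u v w _ _ ih₁ ih₂ =>
      rcases ih₁ with rfl | ih₁
      · exact ih₂
      · rcases ih₂ with rfl | ih₂
        · exact Or.inr ih₁
        · exact Or.inr ⟨ih₁.1, ih₂.2⟩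
  rcases key (hG.2 v (G.src e)) with rfl | h
  · exact ⟨e, Or.inl rfl⟩
  · exact h.1

/-- A connected graph without edges is a point, and nothing flows. -/
theorem hasSpectralFlow_of_isEmpty [IsEmpty E] [Finite V] (hG : G.Connected) (hB : B = ∅) (ε : ℝ) :
    HasSpectralFlow (fun t : EReal => G.deltaOp (Real.pi / 2) B t) 0 ⊤ ε
      (G.betti - (G.cut B).betti) := by
  have hsub : Subsingleton G.L2 := ⟨fun f g => by ext1 e; exact isEmptyElim e⟩
  have hspec : ∀ (A : G.L2 →ₗ.[ℂ] G.L2) (z : ℂ), z ∉ unboundedSpectrum A := fun A z =>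
    not_not.2 ⟨0, fun g => ⟨by rw [Subsingleton.elim ((0 : G.L2 →L[ℂ] G.L2) g) 0]; exact
      A.domain.zero_mem, Subsingleton.elim _ _⟩, fun f => Subsingleton.elim _ _⟩
  have hdim : ∀ (A : G.L2 →ₗ.[ℂ] G.L2) (z : ℂ), dimKer A z = 0 := fun A z =>
    finrank_zero_of_subsingleton
  subst hB
  obtain ⟨⟨v⟩, hv⟩ := hG
  have hVs : Subsingleton V := ⟨fun v w => by
    have h1 := hv v w
    induction h1 with
    | rel v w h => exact isEmptyElim h.choose
    | refl v => rfl
    | symm v w _ ih => exact ih.symm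
    | trans u v w _ _ ih₁ ih₂ => exact ih₁.trans ih₂⟩
  have hc1 : Nat.card G.Components = 1 := Nat.card_eq_one_iff_unique.2
    ⟨⟨fun x y => by
      induction x using Quot.ind
      induction y using Quot.ind
      exact congrArg _ (Subsingleton.elim _ _)⟩, ⟨Quot.mk _ v⟩⟩
  have hVBs : Subsingleton (V ⊕ (∅ : Set V)) := ⟨by
    rintro (x | ⟨x, hx⟩) (y | ⟨y, hy⟩)
    · rw [Subsingleton.elim x y]
    · exact hy.elim
    · exact hx.elim
    · exact hx.elim⟩
  have hc2 : Nat.card (G.cut ∅).Components = 1 := Nat.card_eq_one_iff_unique.2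
    ⟨⟨fun x y => by
      induction x using Quot.ind
      induction y using Quot.ind
      exact congrArg _ (Subsingleton.elim _ _)⟩, ⟨Quot.mk _ (Sum.inl v)⟩⟩
  have hbetti : G.betti - (G.cut ∅).betti = 0 := by
    rw [betti_sub_betti_cut, hc1, hc2]
    simp
  refine ⟨⟨{
    N := 1
    t := ![0, ⊤]
    strictMono := by
      rw [Fin.strictMono_iff_lt_succ]
      intro i
      fin_cases i
      simp
    first := rfl
    last := rfl
    lo := fun _ => ε - 1
    hi := fun _ => ε + 1
    lo_lt := fun _ => by linarith
    lt_hi := fun _ => by linarith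
    lo_notMem := fun _ _ _ => hspec _ _
    hi_notMem := fun _ _ _ => hspec _ _ }⟩, fun P => ?_⟩
  rw [hbetti, FlowPartition.flow]
  simp [hdim]

end MetricGraph

/-! ### The main theorem. -/

theorem theorem3p6 {V E : Type*} [Finite V] [Fintype E] (G : MetricGraph V E)
    (hconn : G.Connected) (B : Set V) (hdeg : ∀ v ∈ B, G.degree v = 2)
    (horient : ∀ v ∈ B, (∃ e, G.tgt e = v) ∧ ∃ e, G.src e = v) :
    ∃ ε₀ : ℝ, 0 < ε₀ ∧ ∀ ε : ℝ, 0 < ε → ε < ε₀ →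
      HasSpectralFlow (fun t : EReal => G.deltaOp (Real.pi / 2) B t) 0 ⊤ ε
        (G.betti - (G.cut B).betti) := by
  have := Fintype.ofFinite V
  have := Fintype.ofFinite B
  rcases isEmpty_or_nonempty E with hE | hE
  · refine ⟨1, one_pos, fun ε _ _ => MetricGraph.hasSpectralFlow_of_isEmpty hconn ?_ ε⟩
    rw [eq_empty_iff_forall_notMem]
    exact fun v hv => isEmptyElim (horient v hv).2.choose
  · obtain ⟨b, hb, hbl⟩ := G.exists_pos_sqrt_mul_len_lt
    have hadm : G.IsAdmissible B b := ⟨hdeg, horient, hconn.exists_end, hbl⟩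
    obtain ⟨δ₁, hδ₁, h₁⟩ := eventually_negIndex_dtn G.len_pos hadm.ends hb hbl
    obtain ⟨δ₂, hδ₂, h₂⟩ := eventually_negIndex_dtn G.len_pos hadm.cut_ends hb hbl
    -- `b` keeps the reduction to vertex values valid; `δ₁` and `δ₂` keep the indices of the uncut
    -- and of the cut graph equal to their numbers of components.
    refine ⟨min b (min δ₁ δ₂), lt_min hb (lt_min hδ₁ hδ₂), fun ε hε hεb => ?_⟩
    rw [lt_min_iff, lt_min_iff] at hεb
    refine ⟨hadm.nonempty_flowPartition hεb.1, fun P => ?_⟩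
    have htop : G.levelIndex B ⊤ ε = Nat.card (G.cut B).Components := by
      rw [MetricGraph.levelIndex, if_neg (by simp), MetricGraph.cutMap, EReal.toReal_top, inv_zero,
        Complex.ofReal_zero, zero_smul, sub_zero, h₂ ε hε hεb.2.2]
      rfl
    have hzero : G.levelIndex B 0 ε = Nat.card G.Components + Nat.card B := by
      rw [MetricGraph.levelIndex, if_pos rfl, h₁ ε hε hεb.2.1, Nat.card_eq_fintype_card (α := B)]
      rfl
    rw [hadm.flow_eq hεb.1, htop, hzero, G.betti_sub_betti_cut]
    push_cast
    ring

end
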